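/- Let $\Gamma$ be a simplicial graph (possibly infinite), $\lambda : E(\Gamma)\to\mathbb{N}_{\ge 2}$ a labelling of its edges, and $\mathcal{G}=\{G_u \mid u\in V(\Gamma)\}$ a collection of groups (the vertex-groups) such that, for every edge $\{u,v\}$, if $\lambda(\{u,v\})>2$ then $G_u$ and $G_v$ both have order two. The periagroup $\Pi=\Pi(\Gamma,\lambda,\mathcal{G})$ is the quotient of the free product of the groups $G_u$, $u \in V(\Gamma)$, by the relations $\langle a,b\rangle^{\lambda(\{u,v\})}=\langle b,a\rangle^{\lambda(\{u,v\})}$ for all edges $\{u,v\}\in E(\Gamma)$ and all non-trivial $a\in G_u$, $b\in G_v$, where $\langle a,b\rangle^k$ denotes the product of the first $k$ letters of $ababab\cdots$. Let $H\le\Pi$ be a subgroup generated by an arbitrary family of conjugates $gG_ug^{-1}$ ($g\in\Pi$, $u\in V(\Gamma)$) of vertex-groups. Then $H$ is itself a periagroup whose vertex-groups belong to $\mathcal{G}$ and sit in $\Pi$ as conjugates of vertex-groups: there exist a simplicial graph $\Delta$, a labelling $\mu:E(\Delta)\to\mathbb{N}_{\ge2}$, a map $f:V(\Delta)\to V(\Gamma)$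 and elements $c_w\in\Pi$ ($w\in V(\Delta)$) such that $\mu(\{w,w'\})>2$ implies that $G_{f(w)}$ and $G_{f(w')}$ both have order two, and such that the maps $G_{f(w)}\to\Pi$, $x\mapsto c_w x c_w^{-1}$, extend to an isomorphism from $\Pi(\Delta,\mu,\{G_{f(w)} \mid w \in V(\Delta)\})$ onto $H$. -/

import Mathlib

universe u v

/-- The alternating word `⟨a, b⟩^k`: the product of the first `k` letters of `a b a b a b ⋯`. -/
def alternatingProd {M : Type*} [Monoid M] (a b : M) : ℕ → M
  | 0 => 1
  | k + 1 => a * alternatingProd b a k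

/-- The standing assumptions on a labelling `lam : E(Γ) → ℕ` and vertex-groups `G`:
all labels are at least `2`, and the vertex-groups at the endpoints of an edge whose label
is greater than `2` both have order two. -/
def IsPeriagroupLabelling {V : Type u} (Γ : SimpleGraph V) (lam : Γ.edgeSet → ℕ)
    (G : V → Type v) : Prop :=
  (∀ e, 2 ≤ lam e) ∧
    ∀ (a b : V) (h : Γ.Adj a b), 2 < lam ⟨s(a, b), h⟩ →
      Nat.card (G a) = 2 ∧ Nat.card (G b) = 2

/-- The relators of a periagroup in the free product of its vertex-groups: one for each edge
`{a, b}` (in either orientation) and all non-trivial `x ∈ G a`, `y ∈ G b`, expressing the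
relation `⟨x, y⟩^k = ⟨y, x⟩^k`, where `k` is the label of the edge. -/
def periagroupRelators {V : Type u} (Γ : SimpleGraph V) (lam : Γ.edgeSet → ℕ)
    (G : V → Type v) [∀ a, Group (G a)] : Set (Monoid.CoprodI G) :=
  {r | ∃ (a b : V) (h : Γ.Adj a b) (x : G a) (y : G b), x ≠ 1 ∧ y ≠ 1 ∧
    r = alternatingProd (Monoid.CoprodI.of x) (Monoid.CoprodI.of y) (lam ⟨s(a, b), h⟩) *
      (alternatingProd (Monoid.CoprodI.of y) (Monoid.CoprodI.of x) (lam ⟨s(a, b), h⟩))⁻¹}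

/-- The periagroup `Π(Γ, lam, G)`, given by its relative presentation. -/
abbrev Periagroup {V : Type u} (Γ : SimpleGraph V) (lam : Γ.edgeSet → ℕ)
    (G : V → Type v) [∀ a, Group (G a)] : Type (max u v) :=
  Monoid.CoprodI G ⧸ Subgroup.normalClosure (periagroupRelators Γ lam G)

/-- The canonical morphism from a vertex-group to the periagroup. -/
def Periagroup.of {V : Type u} (Γ : SimpleGraph V) (lam : Γ.edgeSet → ℕ)
    (G : V → Type v) [∀ a, Group (G a)] (a : V) : G a →* Periagroup Γ lam G :=
  (QuotientGroup.mk' (Subgroup.normalClosure (periagroupRelators Γ lam G))).comp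
    Monoid.CoprodI.of

/-- A vertex-group, seen as a subgroup of the periagroup. -/
def Periagroup.vertexSubgroup {V : Type u} (Γ : SimpleGraph V) (lam : Γ.edgeSet → ℕ)
    (G : V → Type v) [∀ a, Group (G a)] (a : V) : Subgroup (Periagroup Γ lam G) :=
  (Periagroup.of Γ lam G a).range

/-!
The proof extends Dyer's argument for reflection subgroups of Coxeter groups. A periagroup carries a
crossed homomorphism `e` which records, for a group element `g` and a conjugate `J` of a
vertex-group, the rotation `(e g J)⁻¹ ∈ J` that takes the sector of `1` delimited by the hyperplane
of `J` to the sector of `g`. It is built on the presentation, as a morphism to a semidirect product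
(`Periagroup.rotationHom`). For an edge labelled by `2` the relation holds there because the two
vertex-groups commute; for the other edges both sides of the relation cross the same walls, in
opposite orders, and rotations of order two around the same wall are equal
(`alternatingProd_wallRotation_comm`).

Let `H` be generated by a set `S` of conjugates of vertex-groups. The `H`-conjugates of the members
of `S` are walls that cut the periagroup into chambers. Those adjacent to the chamber of `1`
(`orbitBase`) generate `H`, since any element can be brought into that chamber by successive
rotations around them (`IsRotationSystem.sSup_orbitBase`).

It remains to show that such a base of walls gives a presentation of the group it generates, which
uses only the axioms of `IsRotationSystem`. The crossed homomorphism yields the deletion property,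
so that the first letter of a reduced word is determined by the base subgroup that contains it.
If an element has reduced words starting in two different subgroups `A` and `B`, then so does
its component in the subgroup generated by `A` and `B`. Comparing words there shows that this
component is an alternating product `⟨a, b⟩^m = ⟨b, a⟩^m`, that `m` depends on `A` and `B` only, and
that `A` and `B` have order two if `m > 2` (`IsJoint`). Tits' argument then shows that these
relations connect any two reduced words of the same element (`IsRotationSystem.wordProd_eq`), so
that they define the group (`IsRotationSystem.exists_mulEquiv`).
-/

open Subgroup

variable {E : Type*} [Group E]

/-! ### Conjugates of subgroups -/

/-- The conjugate `g J g⁻¹` of a subgroup. -/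
def Subgroup.conjBy (g : E) (J : Subgroup E) : Subgroup E := J.map (MulAut.conj g).toMonoidHom

namespace Subgroup

theorem mem_conjBy {g x : E} {J : Subgroup E} : x ∈ J.conjBy g ↔ g⁻¹ * x * g ∈ J := by
  unfold conjBy
  constructor
  · rintro ⟨y, hy, rfl⟩
    simpa [mul_assoc] using hy
  · intro h
    exact ⟨_, h, by simp [mul_assoc]⟩

theorem conjBy_mul (g h : E) (J : Subgroup E) : J.conjBy (g * h) = (J.conjBy h).conjBy g := by
  ext x; simp [mem_conjBy, mul_assoc]

@[simp] theorem conjBy_one (J : Subgroup E) : J.conjBy 1 = J := by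
  ext x; simp [mem_conjBy]

@[simp] theorem conjBy_inv_conjBy (g : E) (J : Subgroup E) : (J.conjBy g).conjBy g⁻¹ = J := by
  rw [← conjBy_mul]; simp

@[simp] theorem conjBy_conjBy_inv (g : E) (J : Subgroup E) : (J.conjBy g⁻¹).conjBy g = J := by
  rw [← conjBy_mul]; simp

theorem conjBy_eq_iff {g : E} {J K : Subgroup E} : J.conjBy g = K ↔ J = K.conjBy g⁻¹ :=
  ⟨fun h => by rw [← h]; simp, fun h => by rw [h]; simp⟩

theorem conjBy_eq_self {g : E} {J : Subgroup E} (hg : g ∈ J) : J.conjBy g = J := by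
  ext x
  rw [mem_conjBy, J.mul_mem_cancel_right hg, J.mul_mem_cancel_left (J.inv_mem hg)]

theorem conjBy_le {g : E} {J D : Subgroup E} (hg : g ∈ D) (hJ : J ≤ D) : J.conjBy g ≤ D := by
  intro x hx
  have h := D.mul_mem (D.mul_mem hg (hJ (mem_conjBy.1 hx))) (D.inv_mem hg)
  simpa [mul_assoc] using h

end Subgroup

/-! ### Rotation systems -/

/-- An abstract system of rotations in a group `E`. A subgroup `J ∈ walls` stands for a hyperplane
whose sectors are permuted simply transitively by `J`, and `(e g J)⁻¹` is the element of `J` that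
takes the sector of `1` to the sector of `g`; this makes `e` a crossed homomorphism. The subgroups
in `base` are the walls adjacent to the chamber of `1`: a non-trivial rotation around such a wall
crosses that wall and no other one. -/
structure IsRotationSystem (e : E → Subgroup E → E) (walls base : Set (Subgroup E)) : Prop where
  cross_mul : ∀ g h J, e (g * h) J = e g J * (g * e h (J.conjBy g⁻¹) * g⁻¹)
  mem : ∀ g J, e g J ∈ J
  base_subset : base ⊆ walls
  self : ∀ C ∈ base, ∀ a ∈ C, e a C = a⁻¹
  other : ∀ C ∈ base, ∀ a ∈ C, ∀ J ∈ walls, J ≠ C → e a J = 1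
  stable : ∀ C ∈ base, ∀ a ∈ C, ∀ J ∈ walls, J.conjBy a ∈ walls

/-- A list all of whose letters lie in subgroups belonging to `base`. -/
def IsWord (base : Set (Subgroup E)) (L : List E) : Prop := ∀ x ∈ L, ∃ C ∈ base, x ∈ C

/-- The least length of a word in the subgroups of `base` with product `h`; its value is `0` when
`h` is not such a product. -/
noncomputable def wordLength (base : Set (Subgroup E)) (h : E) : ℕ :=
  sInf {n | ∃ L : List E, IsWord base L ∧ L.length = n ∧ L.prod = h}

/-- A word of least length among those with the same product. -/
def IsReducedWord (base : Set (Subgroup E)) (L : List E) : Prop :=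
  IsWord base L ∧ L.length = wordLength base L.prod

/-! ### Words and word length -/

section Words

variable {base : Set (Subgroup E)}

theorem IsWord.nil : IsWord base ([] : List E) := by simp [IsWord]

theorem isWord_cons {x : E} {L : List E} :
    IsWord base (x :: L) ↔ (∃ C ∈ base, x ∈ C) ∧ IsWord base L := by
  simp [IsWord]

theorem isWord_append {L L' : List E} :
    IsWord base (L ++ L') ↔ IsWord base L ∧ IsWord base L' := by
  simp only [IsWord, List.mem_append]
  exact ⟨fun h => ⟨fun x hx => h x (Or.inl hx), fun x hx => h x (Or.inr hx)⟩,
    fun h x hx => hx.elim (h.1 x) (h.2 x)⟩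

theorem IsWord.prod_mem {L : List E} (hL : IsWord base L) : L.prod ∈ sSup base :=
  Subgroup.list_prod_mem _ fun x hx => by
    obtain ⟨C, hC, hxC⟩ := hL x hx
    exact (le_sSup hC : C ≤ sSup base) hxC

theorem exists_isWord {h : E} (hh : h ∈ sSup base) : ∃ L, IsWord base L ∧ L.prod = h := by
  rw [sSup_eq_iSup'] at hh
  induction hh using Subgroup.iSup_induction' with
  | hp C x hx => exact ⟨[x], by simpa [IsWord] using ⟨C.1, C.2, hx⟩, by simp⟩
  | h1 => exact ⟨[], IsWord.nil, rfl⟩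
  | hmul x y _ _ hx hy =>
    obtain ⟨L, hL, rfl⟩ := hx
    obtain ⟨L', hL', rfl⟩ := hy
    exact ⟨L ++ L', isWord_append.2 ⟨hL, hL'⟩, by simp⟩

theorem wordLength_le {L : List E} (hL : IsWord base L) : wordLength base L.prod ≤ L.length :=
  Nat.sInf_le ⟨L, hL, rfl, rfl⟩

theorem exists_isReducedWord {h : E} (hh : h ∈ sSup base) :
    ∃ L, IsReducedWord base L ∧ L.prod = h := by
  obtain ⟨L, hL, rfl⟩ := exists_isWord hh
  obtain ⟨L', hL', h1, h2⟩ := Nat.sInf_mem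
    (⟨_, L, hL, rfl, rfl⟩ : {n | ∃ M : List E, IsWord base M ∧ M.length = n ∧
      M.prod = L.prod}.Nonempty)
  exact ⟨L', ⟨hL', by rw [h1, h2]; rfl⟩, h2⟩

theorem IsReducedWord.length_le {L L' : List E} (hL : IsReducedWord base L) (hL' : IsWord base L')
    (h : L'.prod = L.prod) : L.length ≤ L'.length := by
  rw [hL.2, ← h]; exact wordLength_le hL'

theorem wordLength_one : wordLength base (1 : E) = 0 :=
  Nat.le_zero.1 (wordLength_le (base := base) (L := []) IsWord.nil)

theorem wordLength_mul_le {C : Subgroup E} (hC : C ∈ base) {a h : E} (ha : a ∈ C)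
    (hh : h ∈ sSup base) : wordLength base (a * h) ≤ wordLength base h + 1 := by
  obtain ⟨L, hL, rfl⟩ := exists_isReducedWord hh
  have := wordLength_le (isWord_cons.2 ⟨⟨C, hC, ha⟩, hL.1⟩)
  rw [← hL.2]
  simpa using this

theorem IsReducedWord.of_append {L L' : List E} (h : IsReducedWord base (L ++ L')) :
    IsReducedWord base L ∧ IsReducedWord base L' := by
  have hw := isWord_append.1 h.1
  obtain ⟨M, hM, hMp⟩ := exists_isReducedWord hw.1.prod_mem
  obtain ⟨M', hM', hMp'⟩ := exists_isReducedWord hw.2.prod_mem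
  have h1 := h.length_le (isWord_append.2 ⟨hM.1, hM'.1⟩) (by simp [hMp, hMp'])
  have h2 := wordLength_le hw.1
  have h3 := wordLength_le hw.2
  rw [← hMp, ← hM.2] at h2
  rw [← hMp', ← hM'.2] at h3
  simp only [List.length_append] at h1
  refine ⟨⟨hw.1, ?_⟩, ⟨hw.2, ?_⟩⟩
  · rw [← hMp, ← hM.2]; omega
  · rw [← hMp', ← hM'.2]; omega

theorem IsReducedWord.tail {x : E} {L : List E} (h : IsReducedWord base (x :: L)) :
    IsReducedWord base L :=
  (IsReducedWord.of_append (L := [x]) h).2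

theorem IsReducedWord.of_length {L : List E} (hL : IsWord base L)
    (h : L.length ≤ wordLength base L.prod) : IsReducedWord base L :=
  ⟨hL, le_antisymm h (wordLength_le hL)⟩

end Words

/-! ### Deletion and reduced words in a rotation system -/

namespace IsRotationSystem

variable {e : E → Subgroup E → E} {walls base : Set (Subgroup E)}

theorem mono {base' : Set (Subgroup E)} (hs : IsRotationSystem e walls base)
    (h : base' ⊆ base) : IsRotationSystem e walls base' where
  cross_mul := hs.cross_mul
  mem := hs.mem
  base_subset := h.trans hs.base_subset
  self C hC := hs.self C (h hC)
  other C hC := hs.other C (h hC)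
  stable C hC := hs.stable C (h hC)

theorem cross_one (hs : IsRotationSystem e walls base) (J : Subgroup E) : e 1 J = 1 := by
  have h := hs.cross_mul 1 1 J
  simpa using h

theorem cross_inv (hs : IsRotationSystem e walls base) (g : E) (J : Subgroup E) :
    e g⁻¹ J = g⁻¹ * (e g (J.conjBy g))⁻¹ * g := by
  have h := hs.cross_mul g g⁻¹ (J.conjBy g)
  rw [mul_inv_cancel, hs.cross_one, conjBy_inv_conjBy, eq_comm, mul_eq_one_iff_inv_eq] at h
  rw [h]; group

theorem conjBy_mem_walls (hs : IsRotationSystem e walls base) {h : E} (hh : h ∈ sSup base)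
    {J : Subgroup E} (hJ : J ∈ walls) : J.conjBy h ∈ walls := by
  obtain ⟨L, hL, rfl⟩ := exists_isWord hh
  induction L with
  | nil => simpa using hJ
  | cons x L ih =>
    obtain ⟨⟨C, hC, hx⟩, hL⟩ := isWord_cons.1 hL
    rw [List.prod_cons, conjBy_mul]
    exact hs.stable C hC x hx _ (ih hL hL.prod_mem)

theorem cross_mul_self (hs : IsRotationSystem e walls base) {C : Subgroup E} (hC : C ∈ base)
    {a : E} (ha : a ∈ C) (h : E) : e (a * h) C = e h C * a⁻¹ := by
  rw [hs.cross_mul, hs.self C hC a ha, conjBy_eq_self (inv_mem ha)]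
  group

theorem cross_mul_other (hs : IsRotationSystem e walls base) {C : Subgroup E} (hC : C ∈ base)
    {a : E} (ha : a ∈ C) (h : E) {J : Subgroup E} (hJ : J ∈ walls) (hJC : J ≠ C) :
    e (a * h) J = a * e h (J.conjBy a⁻¹) * a⁻¹ := by
  rw [hs.cross_mul, hs.other C hC a ha J hJ hJC, one_mul]

/-- Deleting from a word all the letters at which the corresponding path crosses `J` amounts to
applying the rotation around `J` that brings the end-point back to the sector of `1`. -/
theorem exists_deletion (hs : IsRotationSystem e walls base) {L : List E} (hL : IsWord base L)
    {J : Subgroup E} (hJ : J ∈ walls) :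
    ∃ L', IsWord base L' ∧ L'.prod = e L.prod J * L.prod ∧ L'.length ≤ L.length ∧
      (e L.prod J ≠ 1 → L'.length < L.length) := by
  induction L generalizing J with
  | nil => exact ⟨[], IsWord.nil, by simp [hs.cross_one], by simp, by simp [hs.cross_one]⟩
  | cons x L ih =>
    obtain ⟨⟨C, hC, hx⟩, hL⟩ := isWord_cons.1 hL
    by_cases hJC : J = C
    · subst hJC
      obtain ⟨L', h1, h2, h3, -⟩ := ih hL hJ
      refine ⟨L', h1, ?_, by simp; omega, fun _ => by simp; omega⟩
      rw [List.prod_cons, hs.cross_mul_self hC hx, h2]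
      group
    · obtain ⟨L', h1, h2, h3, h4⟩ := ih hL (hs.stable C hC x⁻¹ (inv_mem hx) J hJ)
      refine ⟨x :: L', isWord_cons.2 ⟨⟨C, hC, hx⟩, h1⟩, ?_, by simpa using h3, fun h => ?_⟩
      · rw [List.prod_cons, List.prod_cons, hs.cross_mul_other hC hx _ hJ hJC, h2]
        group
      · rw [List.prod_cons, hs.cross_mul_other hC hx _ hJ hJC] at h
        have h5 := h4 fun h6 => h (by rw [h6]; simp)
        simpa using h5

/-- A path that ends in a sector of `J` other than the sector of `1` crosses `J` at some letter. -/
theorem exists_crossing (hs : IsRotationSystem e walls base) {L : List E} (hL : IsWord base L)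
    {J : Subgroup E} (hJ : J ∈ walls) (h : e L.prod J ≠ 1) :
    ∃ L₁ x L₂, L = L₁ ++ x :: L₂ ∧ ∃ C ∈ base, x ∈ C ∧ J = C.conjBy L₁.prod := by
  induction L generalizing J with
  | nil => exact absurd (hs.cross_one J) h
  | cons x L ih =>
    obtain ⟨⟨C, hC, hx⟩, hL⟩ := isWord_cons.1 hL
    by_cases hJC : J = C
    · exact ⟨[], x, L, rfl, C, hC, hx, by simpa using hJC⟩
    · rw [List.prod_cons, hs.cross_mul_other hC hx _ hJ hJC] at h
      obtain ⟨L₁, y, L₂, rfl, C', hC', hy, hJ'⟩ :=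
        ih hL (hs.stable C hC x⁻¹ (inv_mem hx) J hJ) fun h6 => h (by rw [h6]; simp)
      refine ⟨x :: L₁, y, L₂, rfl, C', hC', hy, ?_⟩
      rw [List.prod_cons, conjBy_mul, ← hJ', conjBy_conjBy_inv]

/-- Rotating `h` around a wall that separates it from `1`, back to the sector of `1`, makes it
shorter. -/
theorem wordLength_lt (hs : IsRotationSystem e walls base) {h : E} (hh : h ∈ sSup base)
    {J : Subgroup E} (hJ : J ∈ walls) (hne : e h J ≠ 1) :
    wordLength base (e h J * h) < wordLength base h := by
  obtain ⟨L, hL, rfl⟩ := exists_isReducedWord hh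
  obtain ⟨L', h1, h2, -, h4⟩ := hs.exists_deletion hL.1 hJ
  rw [← h2, ← hL.2]
  exact (wordLength_le h1).trans_lt (h4 hne)

theorem wordLength_mul (hs : IsRotationSystem e walls base) {C : Subgroup E} (hC : C ∈ base)
    {a h : E} (ha : a ∈ C) (ha1 : a ≠ 1) (hh : h ∈ sSup base) (h1 : e h C = 1) :
    wordLength base (a * h) = wordLength base h + 1 := by
  have h2 : e (a * h) C = a⁻¹ := by rw [hs.cross_mul_self hC ha, h1, one_mul]
  have h3 := hs.wordLength_lt (mul_mem ((le_sSup hC : C ≤ sSup base) ha) hh)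
    (hs.base_subset hC) (by rw [h2]; simpa using ha1)
  rw [h2, inv_mul_cancel_left] at h3
  have := wordLength_mul_le hC ha hh
  omega

/-- A word `x :: L` with `x ∈ C` is reduced precisely when `L` is reduced and the wall `C` does not
separate `L.prod` from `1`. -/
theorem isReducedWord_cons (hs : IsRotationSystem e walls base) {C : Subgroup E} (hC : C ∈ base)
    {x : E} (hx : x ∈ C) {L : List E} :
    IsReducedWord base (x :: L) ↔ x ≠ 1 ∧ IsReducedWord base L ∧ e L.prod C = 1 := by
  constructor
  · intro h
    have hx1 : x ≠ 1 := by
      rintro rfl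
      have := h.length_le h.tail.1 (by simp)
      simp at this
    refine ⟨hx1, h.tail, ?_⟩
    by_contra hne
    have hm := h.tail.1.prod_mem
    have h1 := hs.wordLength_lt hm (hs.base_subset hC) hne
    have hc : e L.prod C ∈ C := hs.mem _ _
    have h2 := wordLength_mul_le hC (mul_mem hx (inv_mem hc))
      (mul_mem ((le_sSup hC : C ≤ sSup base) hc) hm)
    have h3 : x * (e L.prod C)⁻¹ * (e L.prod C * L.prod) = (x :: L).prod := by
      rw [List.prod_cons]; group
    rw [h3, ← h.2] at h2
    have := h.tail.2
    simp at h2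
    omega
  · rintro ⟨hx1, hL, h1⟩
    refine ⟨isWord_cons.2 ⟨⟨C, hC, hx⟩, hL.1⟩, ?_⟩
    rw [List.prod_cons, hs.wordLength_mul hC hx hx1 hL.1.prod_mem h1, ← hL.2, List.length_cons]

theorem cross_prod_cons (hs : IsRotationSystem e walls base) {C : Subgroup E} (hC : C ∈ base)
    {x : E} (hx : x ∈ C) {L : List E} (h : IsReducedWord base (x :: L)) :
    e (x :: L).prod C = x⁻¹ := by
  rw [List.prod_cons, hs.cross_mul_self hC hx, ((hs.isReducedWord_cons hC hx).1 h).2.2, one_mul]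

/-- Distinct subgroups of the base meet trivially. -/
theorem eq_of_mem (hs : IsRotationSystem e walls base) {C C' : Subgroup E} (hC : C ∈ base)
    (hC' : C' ∈ base) {x : E} (hx : x ∈ C) (hx' : x ∈ C') (hx1 : x ≠ 1) : C = C' := by
  by_contra hne
  have := hs.other C' hC' x hx' C (hs.base_subset hC) hne
  rw [hs.self C hC x hx] at this
  exact hx1 (by simpa using this)

end IsRotationSystem

/-! ### Alternating words and the rank-two case -/

/-- The alternating list `a, b, a, …` with `n` entries. -/
def altList {α : Type*} (a b : α) : ℕ → List α
  | 0 => []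
  | n + 1 => a :: altList b a n

theorem prod_altList (a b : E) (n : ℕ) : (altList a b n).prod = alternatingProd a b n := by
  induction n generalizing a b with
  | zero => rfl
  | succ n ih => simp [altList, alternatingProd, ih]

theorem map_alternatingProd {M N : Type*} [Monoid M] [Monoid N] (f : M →* N) (a b : M) (n : ℕ) :
    f (alternatingProd a b n) = alternatingProd (f a) (f b) n := by
  induction n generalizing a b with
  | zero => simp [alternatingProd]
  | succ n ih => simp [alternatingProd, ih]

theorem map_altList {α β : Type*} (f : α → β) (a b : α) (n : ℕ) :
    (altList a b n).map f = altList (f a) (f b) n := by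
  induction n generalizing a b with
  | zero => rfl
  | succ n ih => simp [altList, ih]

/-- A list that is periodic with period two, as expressed by the two ways of splitting it, is
alternating. -/
theorem eq_altList_of_append_eq {α : Type*} (a b x y : α) :
    ∀ L : List α, L ++ [x, y] = a :: b :: L → L ++ [x, y] = altList a b (L.length + 2)
  | [], h => by simpa [altList] using h
  | [c], h => by simp_all [altList]
  | c :: d :: L, h => by
    simp only [List.cons_append, List.cons.injEq] at h
    obtain ⟨rfl, rfl, h⟩ := h
    have := eq_altList_of_append_eq c d x y L h
    simp [altList, this]

/-- The letters of the list lie alternately in `A` and in `B`, starting with `A`. -/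
def AltMem (A B : Subgroup E) : List E → Prop
  | [] => True
  | x :: L => x ∈ A ∧ AltMem B A L

theorem AltMem.mem_of_cancel {A B : Subgroup E} {x y : E} {L₁ L₂ : List E}
    (h : AltMem A B (L₁ ++ x :: y :: L₂)) (h' : AltMem A B (L₁ ++ y :: L₂)) : y ∈ A ∧ y ∈ B := by
  induction L₁ generalizing A B with
  | nil => exact ⟨h'.1, h.2.1⟩
  | cons c L₁ ih => exact (ih h.2 h'.2).symm

namespace IsRotationSystem

variable {e : E → Subgroup E → E} {walls : Set (Subgroup E)} {A B : Subgroup E}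

theorem altMem_of_isReducedWord (hs : IsRotationSystem e walls {A, B}) {x : E} {L : List E}
    (h : IsReducedWord {A, B} (x :: L)) (hx : x ∈ A) : AltMem A B (x :: L) := by
  induction L generalizing x A B with
  | nil => exact ⟨hx, trivial⟩
  | cons y L ih =>
    refine ⟨hx, ?_⟩
    obtain ⟨C, hC, hy⟩ := (isWord_cons.1 h.tail.1).1
    have h1 := ((hs.isReducedWord_cons (by simp) hx).1 h).2.2
    rcases hC with rfl | rfl
    · rw [hs.cross_prod_cons (by simp) hy h.tail] at h1
      exact absurd (inv_eq_one.1 h1) ((hs.isReducedWord_cons (by simp) hy).1 h.tail).1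
    · rw [Set.pair_comm] at hs h
      exact ih hs h.tail hy

/-- A reduced word over two subgroups of the base is determined by its product and by the subgroup
that contains its first letter. -/
theorem eq_of_altMem (hs : IsRotationSystem e walls {A, B}) {L L' : List E}
    (h : IsReducedWord {A, B} L) (h' : IsReducedWord {A, B} L') (ha : AltMem A B L)
    (ha' : AltMem A B L') (hp : L.prod = L'.prod) : L = L' := by
  have hlen : L.length = L'.length := by rw [h.2, h'.2, hp]
  induction L generalizing A B L' with
  | nil => exact (List.length_eq_zero_iff.1 hlen.symm).symm
  | cons x L ih =>
    cases L' with
    | nil => simp at hlen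
    | cons x' L' =>
      have h1 := hs.cross_prod_cons (by simp) ha.1 h
      rw [hp, hs.cross_prod_cons (by simp) ha'.1 h', inv_inj] at h1
      subst h1
      rw [Set.pair_comm] at hs h h'
      rw [ih hs h.tail h'.tail ha.2 ha'.2 (by simpa using hp) (by simpa using hlen)]

/-- If a reduced word starting with a letter of `A` represents an element that also has a reduced
word starting with `b ∈ B`, then the wall `B` is crossed at the last letter of the word: a letter
crossing `B` elsewhere would have neighbours that could be merged once it is deleted. -/
theorem exists_eq_append (hs : IsRotationSystem e walls {A, B}) (hAB : A ≠ B) {L : List E}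
    (h : IsReducedWord {A, B} L) (ha : AltMem A B L) {b : E} (hb : e L.prod B = b⁻¹)
    (hb1 : b ≠ 1) :
    ∃ L₁ x, L = L₁ ++ [x] ∧ b * L₁.prod = L.prod ∧
      ∃ C ∈ ({A, B} : Set (Subgroup E)), x ∈ C ∧ B = C.conjBy L₁.prod := by
  have hB : B ∈ ({A, B} : Set (Subgroup E)) := by simp
  have hbB : b ∈ B := by
    have := hs.mem L.prod B
    rwa [hb, inv_mem_iff] at this
  obtain ⟨L₁, x, L₂, rfl, C, hC, hx, hBC⟩ := hs.exists_crossing h.1 (hs.base_subset hB)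
    (by rw [hb]; simpa using hb1)
  have hwx := isWord_append.1 h.1
  have hw : IsWord {A, B} (L₁ ++ L₂) := isWord_append.2 ⟨hwx.1, (isWord_cons.1 hwx.2).2⟩
  set z := (L₁ ++ x :: L₂).prod with hz
  obtain ⟨y, hy⟩ : ∃ y, z = b * y := ⟨b⁻¹ * z, by group⟩
  have hyB : e y B = 1 := by
    have h1 := hs.cross_mul_self hB hbB y
    rw [← hy, hb] at h1
    exact (mul_eq_right.1 h1.symm)
  have hym : y ∈ sSup {A, B} := by
    have h1 : y = b⁻¹ * z := by rw [hy]; group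
    rw [h1]
    exact mul_mem (inv_mem ((le_sSup hB : B ≤ sSup {A, B}) hbB)) h.1.prod_mem
  have hlen := hs.wordLength_mul hB hbB hb1 hym hyB
  rw [← hy, ← h.2] at hlen
  have hle := wordLength_le hw
  have ht : L₁.prod * x * L₁.prod⁻¹ ∈ B := by
    rw [hBC, mem_conjBy]
    simpa [mul_assoc] using hx
  -- The rotation `t` that deletes the letter `x` from the word must be `b` itself: otherwise
  -- `t⁻¹ * z = (t⁻¹ * b) * y` would have the length of `z`.
  have htb : L₁.prod * x * L₁.prod⁻¹ = b := by
    by_contra hne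
    have h1 := hs.wordLength_mul hB (mul_mem (inv_mem ht) hbB) (fun h1 => hne (by
      rwa [inv_mul_eq_one] at h1)) hym hyB
    have h2 : (L₁.prod * x * L₁.prod⁻¹)⁻¹ * b * y = (L₁ ++ L₂).prod := by
      rw [mul_assoc, ← hy, hz]; simp [mul_assoc]
    rw [h2] at h1
    simp at h1 hle hlen
    omega
  have hbz : b * (L₁ ++ L₂).prod = z := by
    rw [← htb, hz]; simp [mul_assoc]
  have hprod : (L₁ ++ L₂).prod = y := by
    rw [hy] at hbz; exact mul_left_cancel hbz
  have hred : IsReducedWord {A, B} (L₁ ++ L₂) :=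
    IsReducedWord.of_length hw (by rw [hprod]; simp at hlen ⊢; omega)
  -- If the deleted letter had neighbours on both sides, they would lie in the same subgroup.
  cases L₂ with
  | nil => exact ⟨L₁, x, rfl, by simpa using hbz, C, hC, hx, hBC⟩
  | cons c L₂ =>
    exfalso
    have key : ∀ d, d ≠ 1 → d ∈ A → d ∈ B → False := fun d h1 hA hB' =>
      hAB (hs.eq_of_mem (by simp) hB hA hB' h1)
    cases L₁ with
    | nil =>
      simp only [List.prod_nil, conjBy_one] at hBC
      subst hBC
      exact key x ((hs.isReducedWord_cons hB hx).1 h).1 ha.1 hx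
    | cons d L₁ =>
      have h1 := ha.mem_of_cancel (hs.altMem_of_isReducedWord hred ha.1)
      have h2 : IsReducedWord {A, B} (c :: L₂) := hred.of_append.2
      exact key c ((hs.isReducedWord_cons hB h1.2).1 h2).1 h1.1 h1.2

end IsRotationSystem

/-- The element `z` of the subgroup generated by `A` and `B` has length `m` with respect to `A` and
`B`, and it has reduced words starting with the non-trivial letters `a ∈ A` and `b ∈ B`. -/
structure IsJoint (e : E → Subgroup E → E) (A B : Subgroup E) (a b : E) (m : ℕ) (z : E) :
    Prop where
  mem : z ∈ sSup ({A, B} : Set (Subgroup E))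
  length : wordLength {A, B} z = m
  left : e z A = a⁻¹
  right : e z B = b⁻¹
  left_ne : a ≠ 1
  right_ne : b ≠ 1

namespace IsJoint

variable {e : E → Subgroup E → E} {walls : Set (Subgroup E)} {A B : Subgroup E} {a b z : E} {m : ℕ}

theorem symm (h : IsJoint e A B a b m z) : IsJoint e B A b a m z where
  mem := by rw [Set.pair_comm]; exact h.mem
  length := by rw [Set.pair_comm]; exact h.length
  left := h.right
  right := h.left
  left_ne := h.right_ne
  right_ne := h.left_ne

theorem left_mem (h : IsJoint e A B a b m z) (hs : IsRotationSystem e walls {A, B}) : a ∈ A := by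
  have := hs.mem z A
  rwa [h.left, inv_mem_iff] at this

theorem cross_inv_mul (h : IsJoint e A B a b m z) (hs : IsRotationSystem e walls {A, B}) :
    e (a⁻¹ * z) A = 1 := by
  rw [hs.cross_mul_self (by simp) (inv_mem (h.left_mem hs)), h.left]; simp

theorem inv_mul_mem (h : IsJoint e A B a b m z) (hs : IsRotationSystem e walls {A, B}) :
    a⁻¹ * z ∈ sSup ({A, B} : Set (Subgroup E)) :=
  mul_mem (inv_mem ((le_sSup (by simp) : A ≤ sSup {A, B}) (h.left_mem hs))) h.mem

theorem wordLength_inv_mul (h : IsJoint e A B a b m z) (hs : IsRotationSystem e walls {A, B})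
    {c : E} (hc : c ∈ A) (hc1 : c ≠ 1) : wordLength {A, B} (c * (a⁻¹ * z)) = m := by
  rw [hs.wordLength_mul (by simp) hc hc1 (h.inv_mul_mem hs) (h.cross_inv_mul hs),
    ← hs.wordLength_mul (by simp) (h.left_mem hs) h.left_ne (h.inv_mul_mem hs) (h.cross_inv_mul hs),
    mul_inv_cancel_left, h.length]

/-- Comparing the reduced words of `z` that start in `A` and in `B` shows that each of them is
obtained from the other one by dropping the last letter and adding a first one; so both of them
are periodic with period two. -/
theorem exists_word (h : IsJoint e A B a b m z) (hs : IsRotationSystem e walls {A, B})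
    (hAB : A ≠ B) :
    IsReducedWord {A, B} (altList a b m) ∧ (altList a b m).prod = z ∧
      ∃ L, L.length + 2 = m ∧ IsWord {A, B} (b :: L) ∧ a * (b :: L).prod = z ∧
        ∃ C ∈ ({A, B} : Set (Subgroup E)), A = C.conjBy (b :: L).prod := by
  have hA : A ∈ ({A, B} : Set (Subgroup E)) := by simp
  have hs' := hs
  rw [Set.pair_comm] at hs'
  have ha := h.left_mem hs
  have hb := h.symm.left_mem hs'
  obtain ⟨M, hM, hMp⟩ := exists_isReducedWord (h.inv_mul_mem hs)
  have hred : IsReducedWord {A, B} (a :: M) :=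
    (hs.isReducedWord_cons hA ha).2 ⟨h.left_ne, hM, by rw [hMp]; exact h.cross_inv_mul hs⟩
  have hz : (a :: M).prod = z := by rw [List.prod_cons, hMp]; group
  have hlen : (a :: M).length = m := by rw [hred.2, hz, h.length]
  obtain ⟨L₁, x, hL₁, hbL, -⟩ := hs.exists_eq_append hAB hred (hs.altMem_of_isReducedWord hred ha)
    (by rw [hz, h.right]) h.right_ne
  have hL₁w : IsWord {A, B} L₁ := (isWord_append.1 (hL₁ ▸ hred.1)).1
  have hredb : IsReducedWord {A, B} (b :: L₁) :=
    IsReducedWord.of_length (isWord_cons.2 ⟨⟨B, by simp, hb⟩, hL₁w⟩) (by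
      rw [List.prod_cons, hbL, ← hred.2, hL₁]; simp)
  have hredb' := hredb
  rw [Set.pair_comm] at hredb'
  obtain ⟨P, x', hP, haP, C, hC, -, hAC⟩ := hs'.exists_eq_append hAB.symm hredb'
    (hs'.altMem_of_isReducedWord hredb' hb) (b := a) (by
      rw [List.prod_cons, hbL, hz, h.left]) h.left_ne
  rw [List.prod_cons, hbL, hz] at haP
  rw [Set.pair_comm] at hC
  have hPw : IsWord {A, B} P := (isWord_append.1 (hP ▸ hredb.1)).1
  have hreda : IsReducedWord {A, B} (a :: P) :=
    IsReducedWord.of_length (isWord_cons.2 ⟨⟨A, hA, ha⟩, hPw⟩) (by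
      have := congrArg List.length hP
      have h2 := congrArg List.length hL₁
      rw [List.prod_cons, haP, h.length, ← hlen]; simp at this h2 ⊢; omega)
  -- `a :: M` and `a :: P` are reduced words of `z` starting in `A`, and `b :: L₁ = P ++ [x']`.
  have hPM : a :: M = a :: P := hs.eq_of_altMem hred hreda (hs.altMem_of_isReducedWord hred ha)
    (hs.altMem_of_isReducedWord hreda ha) (by rw [hz, List.prod_cons, haP])
  cases P with
  | nil =>
    exfalso
    have h1 : a = z := by simpa using haP
    have h2 := congrArg List.length hP
    have h3 : L₁ = [] := by simpa using h2
    subst h3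
    have h4 : b = z := by rw [← hz, ← hbL]; simp
    exact hAB (hs.eq_of_mem hA (by simp) ha (by rw [h1, ← h4]; exact hb) h.left_ne)
  | cons b' L =>
    simp only [List.cons_append, List.cons.injEq] at hP
    obtain ⟨rfl, rfl⟩ := hP
    have h1 : L ++ [x', x] = a :: b :: L := by rw [← hPM, hL₁]; simp
    have h2 := eq_altList_of_append_eq _ _ _ _ _ h1
    have h3 : L.length + 2 = m := by
      rw [← hlen, hPM]; simp
    rw [h1, ← hPM, h3] at h2
    rw [← h2]
    exact ⟨hred, hz, L, h3, hPw, haP, C, hC, hAC⟩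

theorem two_le (h : IsJoint e A B a b m z) (hs : IsRotationSystem e walls {A, B})
    (hAB : A ≠ B) : 2 ≤ m := by
  obtain ⟨-, -, L, hL, -⟩ := h.exists_word hs hAB
  omega

theorem eq_alternatingProd (h : IsJoint e A B a b m z) (hs : IsRotationSystem e walls {A, B})
    (hAB : A ≠ B) : z = alternatingProd a b m := by
  rw [← prod_altList, (h.exists_word hs hAB).2.1]

theorem alternatingProd_comm (h : IsJoint e A B a b m z) (hs : IsRotationSystem e walls {A, B})
    (hAB : A ≠ B) : alternatingProd a b m = alternatingProd b a m := by
  have hs' := hs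
  rw [Set.pair_comm] at hs'
  rw [← h.eq_alternatingProd hs hAB, ← h.symm.eq_alternatingProd hs' hAB.symm]

/-- Rotating `z` around `A` only changes the last letter of the reduced word of `z` that starts
in `B`. -/
theorem change_left (h : IsJoint e A B a b m z) (hs : IsRotationSystem e walls {A, B})
    (hAB : A ≠ B) {c : E} (hc : c ∈ A) (hc1 : c ≠ 1) :
    IsJoint e A B c b m (c * (a⁻¹ * z)) := by
  have hA : A ∈ ({A, B} : Set (Subgroup E)) := by simp
  have hs' := hs
  rw [Set.pair_comm] at hs'
  obtain ⟨-, -, L, hL, hw, hz, C, hC, hAC⟩ := h.exists_word hs hAB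
  have hb := h.symm.left_mem hs'
  have hlen := h.wordLength_inv_mul hs hc hc1
  have hx : (b :: L).prod⁻¹ * c * (b :: L).prod ∈ C := by
    rw [← mem_conjBy, ← hAC]; exact hc
  have hprod : (b :: (L ++ [(b :: L).prod⁻¹ * c * (b :: L).prod])).prod = c * (a⁻¹ * z) := by
    rw [← hz, inv_mul_cancel_left, ← List.cons_append, List.prod_append]
    simp only [List.prod_cons (a := (b :: L).prod⁻¹ * c * (b :: L).prod), List.prod_nil]
    group
  have hred : IsReducedWord {A, B} (b :: (L ++ [(b :: L).prod⁻¹ * c * (b :: L).prod])) := by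
    refine IsReducedWord.of_length ?_ ?_
    · rw [← List.cons_append]
      exact isWord_append.2 ⟨hw, isWord_cons.2 ⟨⟨C, hC, hx⟩, IsWord.nil⟩⟩
    · rw [hprod, hlen, ← hL]; simp
  refine ⟨hprod ▸ hred.1.prod_mem, hlen, ?_, ?_, hc1, h.right_ne⟩
  · rw [hs.cross_mul_self hA hc, h.cross_inv_mul hs, one_mul]
  · rw [← hprod, hs.cross_prod_cons (by simp) hb hred]

/-- The existence of a joint and its length do not depend on the first letters. -/
theorem change (h : IsJoint e A B a b m z) (hs : IsRotationSystem e walls {A, B})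
    (hAB : A ≠ B) {c d : E} (hc : c ∈ A) (hc1 : c ≠ 1) (hd : d ∈ B) (hd1 : d ≠ 1) :
    ∃ z', IsJoint e A B c d m z' := by
  have h1 := (h.change_left hs hAB hc hc1).symm
  rw [Set.pair_comm] at hs
  exact ⟨_, (h1.change_left hs hAB.symm hd hd1).symm⟩

/-- In an alternating word of length at least three the letter `a` occurs both in the first and in
the third position, while `change_left` changes the first letter only. -/
theorem eq_of_two_lt (h : IsJoint e A B a b m z) (hs : IsRotationSystem e walls {A, B})
    (hAB : A ≠ B) (hm : 2 < m) {c : E} (hc : c ∈ A) (hc1 : c ≠ 1) : c = a := by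
  have h' := h.change_left hs hAB hc hc1
  have hs' := hs
  rw [Set.pair_comm] at hs'
  have hb := h.symm.left_mem hs'
  obtain ⟨k, rfl⟩ : ∃ k, m = k + 3 := ⟨m - 3, by omega⟩
  obtain ⟨h1, h2, -⟩ := h.exists_word hs hAB
  obtain ⟨h1', h2', -⟩ := h'.exists_word hs hAB
  have h3 : (altList b a (k + 2)).prod = (altList b c (k + 2)).prod := by
    simp only [altList, List.prod_cons] at h2 h2' ⊢
    rw [← h2] at h2'
    have := mul_left_cancel h2'
    rw [this]; group
  have h4 := hs'.eq_of_altMem (by rw [Set.pair_comm]; exact h1.tail)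
    (by rw [Set.pair_comm]; exact h1'.tail)
    (hs'.altMem_of_isReducedWord (by rw [Set.pair_comm]; exact h1.tail) hb)
    (hs'.altMem_of_isReducedWord (by rw [Set.pair_comm]; exact h1'.tail) hb) h3
  simp only [altList, List.cons.injEq] at h4
  exact h4.2.1.symm

theorem card_eq_two (h : IsJoint e A B a b m z) (hs : IsRotationSystem e walls {A, B})
    (hAB : A ≠ B) (hm : 2 < m) : Nat.card A = 2 := by
  rw [Nat.card_eq_two_iff]
  refine ⟨1, ⟨a, h.left_mem hs⟩, fun h1 => h.left_ne (congrArg Subtype.val h1).symm, ?_⟩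
  rw [Set.eq_univ_iff_forall]
  rintro ⟨c, hc⟩
  by_cases hc1 : c = 1
  · left; ext; exact hc1
  · right; exact Subtype.ext (h.eq_of_two_lt hs hAB hm hc hc1)

/-- No alternating word longer than a joint with the same letters is reduced, because one of its
suffixes is a joint. -/
theorem not_isReducedWord (h : IsJoint e A B a b m z) (hs : IsRotationSystem e walls {A, B})
    (hAB : A ≠ B) {n : ℕ} (hn : m < n) : ¬ IsReducedWord {A, B} (altList a b n) := by
  induction n generalizing A B a b with
  | zero => omega
  | succ n ih =>
    intro hred
    have hs' := hs
    rw [Set.pair_comm] at hs'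
    rcases (Nat.lt_succ_iff.1 hn).lt_or_eq with hlt | rfl
    · have h1 := hred.tail
      rw [Set.pair_comm] at h1
      exact ih h.symm hs' hAB.symm hlt h1
    · have h1 := ((hs.isReducedWord_cons (by simp) (h.left_mem hs)).1 hred).2.2
      rw [(h.symm.exists_word hs' hAB.symm).2.1, h.left] at h1
      exact h.left_ne (inv_eq_one.1 h1)

/-- All joints of `A` and `B` have the same length. -/
theorem length_unique (h : IsJoint e A B a b m z) (hs : IsRotationSystem e walls {A, B})
    (hAB : A ≠ B) {c d z' : E} {n : ℕ} (h' : IsJoint e A B c d n z') : m = n := by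
  have hs' := hs
  rw [Set.pair_comm] at hs'
  obtain ⟨w, hw⟩ := h'.change hs hAB (h.left_mem hs) h.left_ne (h.symm.left_mem hs') h.right_ne
  by_contra hne
  rcases Nat.lt_or_gt_of_ne hne with hlt | hlt
  · exact h.not_isReducedWord hs hAB hlt (hw.exists_word hs hAB).1
  · exact hw.not_isReducedWord hs hAB hlt (h.exists_word hs hAB).1

end IsJoint

/-! ### Generalities on periagroups -/

namespace Periagroup

variable {V : Type u} {Γ : SimpleGraph V} {lam : Γ.edgeSet → ℕ} {G : V → Type v}
  [∀ a, Group (G a)]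

theorem alternatingProd_of_comm {a b : V} (h : Γ.Adj a b) {x : G a} {y : G b} (hx : x ≠ 1)
    (hy : y ≠ 1) :
    alternatingProd (of Γ lam G a x) (of Γ lam G b y) (lam ⟨s(a, b), h⟩) =
      alternatingProd (of Γ lam G b y) (of Γ lam G a x) (lam ⟨s(a, b), h⟩) := by
  have h1 : QuotientGroup.mk' (Subgroup.normalClosure (periagroupRelators Γ lam G)) _ = 1 :=
    (QuotientGroup.eq_one_iff _).2
      (Subgroup.subset_normalClosure ⟨a, b, h, x, y, hx, hy, rfl⟩)
  rw [map_mul, map_inv, mul_inv_eq_one, map_alternatingProd, map_alternatingProd] at h1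
  exact h1

/-- The universal property of the relative presentation. -/
def lift {H : Type*} [Group H] (ι : ∀ a, G a →* H)
    (hι : ∀ (a b : V) (h : Γ.Adj a b) (x : G a) (y : G b), x ≠ 1 → y ≠ 1 →
      alternatingProd (ι a x) (ι b y) (lam ⟨s(a, b), h⟩) =
        alternatingProd (ι b y) (ι a x) (lam ⟨s(a, b), h⟩)) : Periagroup Γ lam G →* H :=
  QuotientGroup.lift _ (Monoid.CoprodI.lift ι) (Subgroup.normalClosure_le_normal (by
    rintro r ⟨a, b, h, x, y, hx, hy, rfl⟩
    simp only [SetLike.mem_coe, MonoidHom.mem_ker]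
    rw [map_mul, map_inv, mul_inv_eq_one, map_alternatingProd, map_alternatingProd]
    simpa using hι a b h x y hx hy))

theorem lift_of {H : Type*} [Group H] (ι : ∀ a, G a →* H)
    (hι : ∀ (a b : V) (h : Γ.Adj a b) (x : G a) (y : G b), x ≠ 1 → y ≠ 1 →
      alternatingProd (ι a x) (ι b y) (lam ⟨s(a, b), h⟩) =
        alternatingProd (ι b y) (ι a x) (lam ⟨s(a, b), h⟩)) (a : V) (x : G a) :
    lift ι hι (of Γ lam G a x) = ι a x := by
  simp [lift, of]

theorem induction_left {p : Periagroup Γ lam G → Prop} (g : Periagroup Γ lam G) (one : p 1)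
    (mul : ∀ (a : V) (x : G a) (g), p g → p (of Γ lam G a x * g)) : p g := by
  induction g using QuotientGroup.induction_on with
  | H g =>
    induction g using Monoid.CoprodI.induction_left with
    | one => exact one
    | mul x g ih => exact mul _ x _ ih

end Periagroup

/-! ### Cosets of the subgroup generated by two members of the base -/

namespace IsRotationSystem

variable {e : E → Subgroup E → E} {walls base : Set (Subgroup E)}

/-- Every coset of the subgroup generated by `A` and `B` has an element that no wall contained in
this subgroup separates from `1`: any element of least length. -/
theorem exists_coset_rep (hs : IsRotationSystem e walls base) {A B : Subgroup E} (hA : A ∈ base)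
    (hB : B ∈ base) {h : E} (hh : h ∈ sSup base) :
    ∃ z h', z ∈ sSup ({A, B} : Set (Subgroup E)) ∧ h' ∈ sSup base ∧ z * h' = h ∧
      ∀ J ∈ walls, J ≤ sSup {A, B} → e h' J = 1 := by
  set D : Subgroup E := sSup {A, B} with hD
  have hDb : D ≤ sSup base := sSup_le_sSup (by
    rintro C (rfl | rfl) <;> assumption)
  obtain ⟨d, hd, hmin⟩ : ∃ d ∈ D, ∀ d' ∈ D, wordLength base (d * h) ≤ wordLength base (d' * h) :=
    ⟨_, Function.argminOn_mem (fun d => wordLength base (d * h)) (D : Set E) ⟨1, D.one_mem⟩,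
      fun d' hd' => Function.argminOn_le (fun d => wordLength base (d * h)) (D : Set E) hd'⟩
  refine ⟨d⁻¹, d * h, inv_mem hd, mul_mem (hDb hd) hh, by group, fun J hJ hJD => ?_⟩
  by_contra hne
  have h1 := hs.wordLength_lt (mul_mem (hDb hd) hh) hJ hne
  have h2 := hmin _ (mul_mem (hJD (hs.mem (d * h) J)) hd)
  rw [mul_assoc] at h2
  omega

/-- The walls contained in `D` separate `z * h'` from `1` in the same way as they separate `z`
from `1`. -/
theorem cross_mul_coset_rep (hs : IsRotationSystem e walls base) {D : Subgroup E}
    (hD : D ≤ sSup base) {h' : E} (h : ∀ J ∈ walls, J ≤ D → e h' J = 1) {z : E} (hz : z ∈ D)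
    {J : Subgroup E} (hJ : J ∈ walls) (hJD : J ≤ D) : e (z * h') J = e z J := by
  rw [hs.cross_mul, h _ (hs.conjBy_mem_walls (hD (inv_mem hz)) hJ) (conjBy_le (inv_mem hz) hJD)]
  simp

theorem isReducedWord_append (hs : IsRotationSystem e walls base) {base' : Set (Subgroup E)}
    (hb : base' ⊆ base) {L L' : List E} (hL : IsReducedWord base' L) (hL' : IsReducedWord base L')
    (h : ∀ J ∈ walls, J ≤ sSup base' → e L'.prod J = 1) : IsReducedWord base (L ++ L') := by
  induction L with
  | nil => exact hL'
  | cons x L ih =>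
    obtain ⟨C, hC, hx⟩ := (isWord_cons.1 hL.1).1
    obtain ⟨h1, h2, h3⟩ := ((hs.mono hb).isReducedWord_cons hC hx).1 hL
    refine (hs.isReducedWord_cons (hb hC) hx).2 ⟨h1, ih h2, ?_⟩
    change e (L ++ L').prod C = 1
    rw [List.prod_append, hs.cross_mul_coset_rep (sSup_le_sSup hb) h h2.1.prod_mem
      (hs.base_subset (hb hC)) (le_sSup hC), h3]

end IsRotationSystem

/-! ### The presentation of the group generated by the base -/

section Presentation

variable {e : E → Subgroup E → E} {walls base : Set (Subgroup E)}
  {G' : base → Type v} [∀ w, Group (G' w)] {ι : ∀ w, G' w →* E}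

/-- The product, in a group `P` that receives the vertex-groups, of a word in these groups. -/
def wordProd {P : Type*} [Group P] (o : ∀ w, G' w →* P) (L : List (Σ w, G' w)) : P :=
  (L.map fun l => o l.1 l.2).prod

theorem wordProd_cons {P : Type*} [Group P] (o : ∀ w, G' w →* P) (w : base) (x : G' w)
    (L : List (Σ w, G' w)) : wordProd o (⟨w, x⟩ :: L) = o w x * wordProd o L := by
  simp [wordProd]

theorem wordProd_altList_append {P : Type*} [Group P] (o : ∀ w, G' w →* P) (w w' : base)
    (x : G' w) (y : G' w') (n : ℕ) (L : List (Σ w, G' w)) :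
    wordProd o (altList ⟨w, x⟩ ⟨w', y⟩ n ++ L) =
      alternatingProd (o w x) (o w' y) n * wordProd o L := by
  simp [wordProd, map_altList, prod_altList]

theorem IsWord.exists_lift (hι : ∀ w, (ι w).range = w.1) {L : List E} (hL : IsWord base L) :
    ∃ M : List (Σ w, G' w), M.map (fun l => ι l.1 l.2) = L := by
  induction L with
  | nil => exact ⟨[], rfl⟩
  | cons x L ih =>
    obtain ⟨⟨C, hC, hx⟩, hL⟩ := isWord_cons.1 hL
    obtain ⟨M, rfl⟩ := ih hL
    obtain ⟨y, rfl⟩ : x ∈ (ι ⟨C, hC⟩).range := by rw [hι]; exact hx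
    exact ⟨⟨⟨C, hC⟩, y⟩ :: M, rfl⟩

theorem exists_wordProd_eq (hι : ∀ w, (ι w).range = w.1) {h : E} (hh : h ∈ sSup base) :
    ∃ M : List (Σ w, G' w), IsReducedWord base (M.map fun l => ι l.1 l.2) ∧
      wordProd ι M = h := by
  obtain ⟨L, hL, rfl⟩ := exists_isReducedWord hh
  obtain ⟨M, rfl⟩ := hL.1.exists_lift hι
  exact ⟨M, hL, rfl⟩

/-- Tits' solution of the word problem: in a group that satisfies the relations given by the
joints, two reduced words with the same product in `E` have the same product. -/
theorem IsRotationSystem.wordProd_eq (hs : IsRotationSystem e walls base)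
    (hinj : ∀ w, Function.Injective (ι w)) (hι : ∀ w, (ι w).range = w.1)
    {P : Type*} [Group P] (o : ∀ w, G' w →* P)
    (ho : ∀ (w w' : base) (x : G' w) (y : G' w') (m : ℕ) (z : E), w ≠ w' →
      IsJoint e w.1 w'.1 (ι w x) (ι w' y) m z →
        alternatingProd (o w x) (o w' y) m = alternatingProd (o w' y) (o w x) m)
    {L L' : List (Σ w, G' w)} (hL : IsReducedWord base (L.map fun l => ι l.1 l.2))
    (hL' : IsReducedWord base (L'.map fun l => ι l.1 l.2)) (h : wordProd ι L = wordProd ι L') :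
    wordProd o L = wordProd o L' := by
  have hmem : ∀ (w : base) (x : G' w), ι w x ∈ w.1 := fun w x => by
    rw [← hι w]; exact ⟨x, rfl⟩
  obtain ⟨n, hn⟩ : ∃ n, L.length = n := ⟨_, rfl⟩
  induction n generalizing L L' with
  | zero =>
    have h1 := hL'.2
    rw [show (L'.map fun l => ι l.1 l.2).prod = wordProd ι L' from rfl, ← h,
      List.length_eq_zero_iff.1 hn] at h1
    have h2 : L' = [] := by simpa [wordProd, wordLength_one] using h1
    rw [List.length_eq_zero_iff.1 hn, h2]
  | succ n ih =>
    have same : ∀ (w : base) (x y : G' w) (T T' : List (Σ w, G' w)),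
        IsReducedWord base ((⟨w, x⟩ :: T : List (Σ w, G' w)).map fun l => ι l.1 l.2) →
        IsReducedWord base ((⟨w, y⟩ :: T' : List (Σ w, G' w)).map fun l => ι l.1 l.2) →
        wordProd ι (⟨w, x⟩ :: T) = wordProd ι (⟨w, y⟩ :: T') → T.length = n →
        wordProd o (⟨w, x⟩ :: T) = wordProd o (⟨w, y⟩ :: T') := by
      intro w x y T T' h1 h2 h3 h4
      have h5 := hs.cross_prod_cons w.2 (hmem w x) h1
      have h6 := hs.cross_prod_cons w.2 (hmem w y) h2
      have h7 : ι w x = ι w y := by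
        rw [← inv_inj, ← h5, ← h6]
        exact congrArg (fun g => e g w.1) h3
      obtain rfl := hinj w h7
      rw [wordProd_cons, wordProd_cons] at h3 ⊢
      rw [ih h1.tail h2.tail (mul_left_cancel h3) h4]
    cases L with
    | nil => simp at hn
    | cons l T =>
    cases L' with
    | nil =>
      have h1 := hL.2
      rw [show (List.map (fun l => ι l.1 l.2) (l :: T)).prod = wordProd ι [] from h] at h1
      simp [wordProd, wordLength_one] at h1
    | cons l' T' =>
    obtain ⟨w, x⟩ := l
    obtain ⟨w', y⟩ := l'
    have hT : T.length = n := by simpa using hn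
    by_cases hww : w = w'
    · subst hww
      exact same w x y T T' hL hL' h hT
    -- Both words are compared with words that start with the joint of `w` and `w'`.
    have hww' : w.1 ≠ w'.1 := fun h => hww (Subtype.ext h)
    have hb : ({w.1, w'.1} : Set (Subgroup E)) ⊆ base := by
      rintro C (rfl | rfl)
      exacts [w.2, w'.2]
    have hs2 := hs.mono hb
    have hs2' := hs2
    rw [Set.pair_comm] at hs2'
    obtain ⟨z, h', hz, hh', hzh, hrep⟩ := hs.exists_coset_rep w.2 w'.2 hL.1.prod_mem
    have hzh' : z * h' = wordProd ι (⟨w, x⟩ :: T) := hzh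
    have hx1 : e (wordProd ι (⟨w, x⟩ :: T)) w.1 = (ι w x)⁻¹ :=
      hs.cross_prod_cons w.2 (hmem w x) hL
    have hy1 : e (wordProd ι (⟨w, x⟩ :: T)) w'.1 = (ι w' y)⁻¹ := by
      rw [h]; exact hs.cross_prod_cons w'.2 (hmem w' y) hL'
    rw [← hzh', hs.cross_mul_coset_rep (sSup_le_sSup hb) hrep hz (hs.base_subset w.2)
      (le_sSup (by simp))] at hx1
    rw [← hzh', hs.cross_mul_coset_rep (sSup_le_sSup hb) hrep hz (hs.base_subset w'.2)
      (le_sSup (by simp))] at hy1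
    have hj : IsJoint e w.1 w'.1 (ι w x) (ι w' y) (wordLength {w.1, w'.1} z) z :=
      ⟨hz, rfl, hx1, hy1, ((hs.isReducedWord_cons w.2 (hmem w x)).1 hL).1,
        ((hs.isReducedWord_cons w'.2 (hmem w' y)).1 hL').1⟩
    obtain ⟨m, hm⟩ : ∃ m, wordLength {w.1, w'.1} z = m + 1 :=
      ⟨_, (Nat.succ_pred_eq_of_pos (by have := hj.two_le hs2 hww'; omega)).symm⟩
    rw [hm] at hj
    obtain ⟨K, hK, rfl⟩ := exists_wordProd_eq hι hh'
    have hr1 : IsReducedWord base ((altList ⟨w, x⟩ ⟨w', y⟩ (m + 1) ++ K :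
        List (Σ w, G' w)).map fun l => ι l.1 l.2) := by
      rw [List.map_append, map_altList]
      exact hs.isReducedWord_append hb (hj.exists_word hs2 hww').1 hK hrep
    have hr2 : IsReducedWord base ((altList ⟨w', y⟩ ⟨w, x⟩ (m + 1) ++ K :
        List (Σ w, G' w)).map fun l => ι l.1 l.2) := by
      rw [List.map_append, map_altList]
      refine hs.isReducedWord_append (base' := {w'.1, w.1}) (by rwa [Set.pair_comm])
        (hj.symm.exists_word hs2' hww'.symm).1 hK ?_
      rwa [Set.pair_comm]
    have hp1 : wordProd ι (⟨w, x⟩ :: T) =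
        wordProd ι (altList ⟨w, x⟩ ⟨w', y⟩ (m + 1) ++ K) := by
      rw [wordProd_altList_append, ← hj.eq_alternatingProd hs2 hww', hzh]; rfl
    have hp2 : wordProd ι (⟨w', y⟩ :: T') =
        wordProd ι (altList ⟨w', y⟩ ⟨w, x⟩ (m + 1) ++ K) := by
      rw [wordProd_altList_append, ← hj.symm.eq_alternatingProd hs2' hww'.symm, hzh]
      exact h.symm
    have hT' : T'.length = n := by
      have h1 := hL.2
      have h2 := hL'.2
      rw [show (List.map (fun l => ι l.1 l.2) (⟨w', y⟩ :: T')).prod =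
        (List.map (fun l => ι l.1 l.2) (⟨w, x⟩ :: T)).prod from h.symm, ← h1] at h2
      simpa [hT] using h2
    rw [same w x x T _ hL hr1 hp1 hT, same w' y y T' _ hL' hr2 hp2 hT']
    change wordProd o (altList ⟨w, x⟩ ⟨w', y⟩ (m + 1) ++ K) =
      wordProd o (altList ⟨w', y⟩ ⟨w, x⟩ (m + 1) ++ K)
    rw [wordProd_altList_append, wordProd_altList_append, ho w w' x y _ z hww hj]

/-- The length of the joints of `A` and `B`; its value is `0` if there is no joint. -/
noncomputable def jointLength (e : E → Subgroup E → E) (A B : Subgroup E) : ℕ :=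
  sInf {n | ∃ a b z, IsJoint e A B a b n z}

theorem jointLength_comm (e : E → Subgroup E → E) (A B : Subgroup E) :
    jointLength e A B = jointLength e B A := by
  unfold jointLength
  congr 1
  ext n
  exact ⟨fun ⟨a, b, z, h⟩ => ⟨b, a, z, h.symm⟩, fun ⟨a, b, z, h⟩ => ⟨b, a, z, h.symm⟩⟩

theorem IsJoint.jointLength_eq {A B : Subgroup E} {a b z : E} {m : ℕ}
    (h : IsJoint e A B a b m z) (hs : IsRotationSystem e walls {A, B}) (hAB : A ≠ B) :
    jointLength e A B = m := by
  have h1 : {n | ∃ a b z, IsJoint e A B a b n z} = {m} := by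
    ext n
    constructor
    · rintro ⟨c, d, z', h'⟩
      exact (h.length_unique hs hAB h').symm
    · rintro rfl
      exact ⟨a, b, z, h⟩
  rw [jointLength, h1, csInf_singleton]

/-- Two subgroups of the base are adjacent when they have a joint. -/
def jointGraph (e : E → Subgroup E → E) (base : Set (Subgroup E)) : SimpleGraph base where
  Adj w w' := w ≠ w' ∧ ∃ n a b z, IsJoint e w.1 w'.1 a b n z
  symm := ⟨fun _ _ ⟨h, n, a, b, z, hj⟩ => ⟨h.symm, n, b, a, z, hj.symm⟩⟩
  loopless := ⟨fun _ h => h.1 rfl⟩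

/-- The label of an edge is the length of the joints of its end-points. -/
noncomputable def jointLabel (e : E → Subgroup E → E) (base : Set (Subgroup E))
    (s : (jointGraph e base).edgeSet) : ℕ :=
  Sym2.lift ⟨fun w w' : base => jointLength e w.1 w'.1, fun _ _ => jointLength_comm e _ _⟩ s.1

theorem IsRotationSystem.mono_pair (hs : IsRotationSystem e walls base) (w w' : base) :
    IsRotationSystem e walls {w.1, w'.1} :=
  hs.mono (by rintro C (rfl | rfl); exacts [w.2, w'.2])

theorem IsRotationSystem.isPeriagroupLabelling (hs : IsRotationSystem e walls base)
    (hinj : ∀ w, Function.Injective (ι w)) (hι : ∀ w, (ι w).range = w.1) :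
    IsPeriagroupLabelling (jointGraph e base) (jointLabel e base) G' := by
  have hcard : ∀ w : base, Nat.card w.1 = 2 → Nat.card (G' w) = 2 := fun w h => by
    rw [← h, ← hι w]
    exact Nat.card_congr (MonoidHom.ofInjective (hinj w)).toEquiv
  constructor
  · rintro ⟨s, h⟩
    induction s with
    | h w w' =>
    obtain ⟨hne, n, a, b, z, hj⟩ := h
    have hne' : w.1 ≠ w'.1 := fun h => hne (Subtype.ext h)
    have hp := hs.mono_pair w w'
    change 2 ≤ jointLength e w.1 w'.1
    rw [hj.jointLength_eq hp hne']
    exact hj.two_le hp hne'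
  · rintro w w' ⟨hne, n, a, b, z, hj⟩ h
    have hne' : w.1 ≠ w'.1 := fun h => hne (Subtype.ext h)
    have hp := hs.mono_pair w w'
    change 2 < jointLength e w.1 w'.1 at h
    rw [hj.jointLength_eq hp hne'] at h
    refine ⟨hcard w (hj.card_eq_two hp hne' h), hcard w' ?_⟩
    rw [Set.pair_comm] at hp
    exact hj.symm.card_eq_two hp hne'.symm h

/-- The subgroup generated by the base of a rotation system is a periagroup whose vertex-groups are
the subgroups of the base. -/
theorem IsRotationSystem.exists_mulEquiv (hs : IsRotationSystem e walls base)
    (hinj : ∀ w, Function.Injective (ι w)) (hι : ∀ w, (ι w).range = w.1) :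
    ∃ φ : Periagroup (jointGraph e base) (jointLabel e base) G' ≃* (sSup base : Subgroup E),
      ∀ w x, (φ (Periagroup.of (jointGraph e base) (jointLabel e base) G' w x) : E) = ι w x := by
  have hmem : ∀ (w : base) (x : G' w), ι w x ∈ w.1 := fun w x => by
    rw [← hι w]; exact ⟨x, rfl⟩
  have hrel : ∀ (w w' : base) (h : (jointGraph e base).Adj w w') (x : G' w) (y : G' w'),
      x ≠ 1 → y ≠ 1 →
      alternatingProd (ι w x) (ι w' y) (jointLabel e base ⟨s(w, w'), h⟩) =
        alternatingProd (ι w' y) (ι w x) (jointLabel e base ⟨s(w, w'), h⟩) := by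
    rintro w w' ⟨hne, n, a, b, z, hj⟩ x y hx hy
    have hne' : w.1 ≠ w'.1 := fun h => hne (Subtype.ext h)
    have hp := hs.mono_pair w w'
    change alternatingProd _ _ (jointLength e w.1 w'.1) =
      alternatingProd _ _ (jointLength e w.1 w'.1)
    rw [hj.jointLength_eq hp hne']
    obtain ⟨z', hz'⟩ := hj.change hp hne' (hmem w x) ((map_ne_one_iff _ (hinj w)).2 hx)
      (hmem w' y) ((map_ne_one_iff _ (hinj w')).2 hy)
    exact hz'.alternatingProd_comm hp hne'
  set π := Periagroup.lift (lam := jointLabel e base) ι hrel with hπ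
  set o := Periagroup.of (jointGraph e base) (jointLabel e base) G' with ho
  have hπo : ∀ w x, π (o w x) = ι w x := Periagroup.lift_of ι hrel
  have horel : ∀ (w w' : base) (x : G' w) (y : G' w') (m : ℕ) (z : E), w ≠ w' →
      IsJoint e w.1 w'.1 (ι w x) (ι w' y) m z →
        alternatingProd (o w x) (o w' y) m = alternatingProd (o w' y) (o w x) m := by
    intro w w' x y m z hne hj
    have hne' : w.1 ≠ w'.1 := fun h => hne (Subtype.ext h)
    have h1 := Periagroup.alternatingProd_of_comm (lam := jointLabel e base)
      (⟨hne, m, _, _, z, hj⟩ : (jointGraph e base).Adj w w')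
      ((map_ne_one_iff _ (hinj w)).1 hj.left_ne) ((map_ne_one_iff _ (hinj w')).1 hj.right_ne)
    change alternatingProd _ _ (jointLength e w.1 w'.1) =
      alternatingProd _ _ (jointLength e w.1 w'.1) at h1
    rwa [hj.jointLength_eq (hs.mono_pair w w') hne'] at h1
  -- Every element of the periagroup is represented by a reduced word of its image in `E`.
  have hword : ∀ p, ∃ M : List (Σ w, G' w), IsReducedWord base (M.map fun l => ι l.1 l.2) ∧
      wordProd ι M = π p ∧ wordProd o M = p := by
    intro p
    induction p using Periagroup.induction_left with
    | one => exact ⟨[], ⟨IsWord.nil, by simp [wordLength_one]⟩, by simp [wordProd],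
        by simp [wordProd]⟩
    | mul w x p ih =>
      obtain ⟨M, hM, hMp, hMv⟩ := ih
      have hm : π p ∈ sSup base := by rw [← hMp]; exact hM.1.prod_mem
      -- The head of `π p` at `w` is split off before it is multiplied by `x`.
      obtain ⟨c, K, hK, hK1, hcK, hcv⟩ : ∃ (c : G' w) (K : List (Σ w, G' w)),
          IsReducedWord base (K.map fun l : (Σ w, G' w) => ι l.1 l.2) ∧ e (wordProd ι K) w.1 = 1 ∧
          ι w c * wordProd ι K = π p ∧ o w c * wordProd o K = p := by
        by_cases h1 : e (π p) w.1 = 1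
        · exact ⟨1, M, hM, by rw [hMp, h1], by simp [hMp], by simp [hMv]⟩
        have hc' := hs.mem (π p) w.1
        obtain ⟨c, hc⟩ : e (π p) w.1 ∈ (ι w).range := by rw [hι w]; exact hc'
        obtain ⟨K, hK, hKp⟩ := exists_wordProd_eq hι
          (mul_mem ((le_sSup w.2 : w.1 ≤ sSup base) hc') hm)
        have hK1 : e (wordProd ι K) w.1 = 1 := by
          rw [hKp, hs.cross_mul_self w.2 hc', mul_inv_cancel]
        have hp : wordProd ι (⟨w, c⁻¹⟩ :: K) = wordProd ι M := by
          rw [wordProd_cons, hKp, hMp, map_inv, hc, inv_mul_cancel_left]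
        have hr : IsReducedWord base
            ((⟨w, c⁻¹⟩ :: K : List (Σ w, G' w)).map fun l => ι l.1 l.2) :=
          (hs.isReducedWord_cons w.2 (hmem w c⁻¹)).2
            ⟨by rw [map_inv, hc]; simpa using h1, hK, hK1⟩
        refine ⟨c⁻¹, K, hK, hK1, ?_, ?_⟩
        · rw [← wordProd_cons, hp, hMp]
        · rw [← wordProd_cons, hs.wordProd_eq hinj hι o horel hr hM hp, hMv]
      by_cases hxc : x * c = 1
      · refine ⟨K, hK, ?_, ?_⟩
        · rw [map_mul, hπo, ← hcK, ← mul_assoc, ← map_mul, hxc, map_one, one_mul]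
        · rw [← hcv, ← ho, ← mul_assoc, ← map_mul, hxc, map_one, one_mul]
      · refine ⟨⟨w, x * c⟩ :: K, (hs.isReducedWord_cons w.2 (hmem w (x * c))).2
          ⟨(map_ne_one_iff _ (hinj w)).2 hxc, hK, hK1⟩, ?_, ?_⟩
        · rw [wordProd_cons, map_mul, map_mul, hπo, ← hcK, mul_assoc]
        · rw [wordProd_cons, map_mul, mul_assoc, hcv]
  have hπinj : Function.Injective π := by
    rw [injective_iff_map_eq_one]
    intro p hp
    obtain ⟨M, hM, hMp, rfl⟩ := hword p
    have h1 := hM.2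
    rw [show (List.map (fun l => ι l.1 l.2) M).prod = 1 from hMp.trans hp, wordLength_one] at h1
    have h2 : M = [] := by simpa using h1
    simp [h2, wordProd]
  have hrange : π.range = sSup base := by
    apply le_antisymm
    · rintro _ ⟨p, rfl⟩
      obtain ⟨M, hM, hMp, -⟩ := hword p
      rw [← hMp]
      exact hM.1.prod_mem
    · refine sSup_le fun C hC y hy => ?_
      obtain ⟨x, rfl⟩ : y ∈ (ι ⟨C, hC⟩).range := by rw [hι]; exact hy
      exact ⟨o _ x, hπo _ x⟩
  exact ⟨(MonoidHom.ofInjective hπinj).trans (MulEquiv.subgroupCongr hrange), hπo⟩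

end Presentation

/-! ### Walls in a subgroup generated by rotations -/

section Heredity

variable {e : E → Subgroup E → E} {base₀ S : Set (Subgroup E)}

/-- The conjugates of the members of `S` by elements of the subgroup that `S` generates. -/
def orbitWalls (S : Set (Subgroup E)) : Set (Subgroup E) :=
  {J | ∃ h ∈ sSup S, ∃ K ∈ S, J = K.conjBy h}

/-- The members of `orbitWalls S` that are adjacent to the chamber of `1` in the partition of `E`
by these walls. -/
def orbitBase (e : E → Subgroup E → E) (S : Set (Subgroup E)) : Set (Subgroup E) :=
  {C | C ∈ orbitWalls S ∧ ∀ k ∈ C, ∀ J ∈ orbitWalls S, J ≠ C → e k J = 1}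

theorem conjBy_mem_orbitWalls {h : E} (hh : h ∈ sSup S) {J : Subgroup E} (hJ : J ∈ orbitWalls S) :
    J.conjBy h ∈ orbitWalls S := by
  obtain ⟨g, hg, K, hK, rfl⟩ := hJ
  exact ⟨h * g, mul_mem hh hg, K, hK, by rw [conjBy_mul]⟩

theorem le_of_mem_orbitWalls {J : Subgroup E} (hJ : J ∈ orbitWalls S) : J ≤ sSup S := by
  obtain ⟨g, hg, K, hK, rfl⟩ := hJ
  exact conjBy_le hg (le_sSup hK)

theorem orbitBase_le : sSup (orbitBase e S) ≤ sSup S :=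
  sSup_le fun _ hC => le_of_mem_orbitWalls hC.1

namespace IsRotationSystem

/-- The normalization `e k C = k⁻¹` for `k ∈ C` extends from the base to all its conjugates. -/
theorem self_conjBy (hs : IsRotationSystem e Set.univ base₀) {C : Subgroup E} (hC : C ∈ base₀)
    (g : E) {k : E} (hk : k ∈ C.conjBy g) : e k (C.conjBy g) = k⁻¹ := by
  have hk' := mem_conjBy.1 hk
  have h1 : k = g * (g⁻¹ * k * g * g⁻¹) := by group
  rw [h1, hs.cross_mul, conjBy_inv_conjBy, hs.cross_mul_self hC hk', hs.cross_inv]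
  group

/-- The subgroup generated by `S` inherits a rotation system. -/
theorem isRotationSystem_orbitBase (hs : IsRotationSystem e Set.univ base₀)
    (hS : ∀ K ∈ S, ∃ g, ∃ C ∈ base₀, K = C.conjBy g) :
    IsRotationSystem e (orbitWalls S) (orbitBase e S) where
  cross_mul := hs.cross_mul
  mem := hs.mem
  base_subset _ hC := hC.1
  self := by
    rintro _ ⟨⟨h, hh, K, hK, rfl⟩, -⟩ a ha
    obtain ⟨g, C, hC, rfl⟩ := hS K hK
    rw [← conjBy_mul] at ha ⊢
    exact hs.self_conjBy hC _ ha
  other C hC a ha J hJ hJC := hC.2 a ha J hJ hJC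
  stable C hC a ha J hJ := conjBy_mem_orbitWalls (le_of_mem_orbitWalls hC.1 ha) hJ

/-- A wall of the family that is adjacent to a chamber contained in the chamber of `1` of the
coarser partition is adjacent to the latter chamber. -/
theorem conjBy_mem_orbitBase (hs : IsRotationSystem e Set.univ base₀) {p : E}
    (hp : ∀ J ∈ orbitWalls S, e p J = 1) {C : Subgroup E} (hC : C ∈ base₀)
    (hCp : C.conjBy p ∈ orbitWalls S) : C.conjBy p ∈ orbitBase e S := by
  refine ⟨hCp, fun k hk J hJ hne => ?_⟩
  have hk' := mem_conjBy.1 hk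
  have h1 : k = p * (p⁻¹ * k * p * p⁻¹) := by group
  have h2 : J.conjBy p⁻¹ ≠ C := fun h => hne (by rw [← h, conjBy_conjBy_inv])
  have h3 : ((J.conjBy p⁻¹).conjBy (p⁻¹ * k * p)⁻¹).conjBy p = J.conjBy k⁻¹ := by
    rw [← conjBy_mul, ← conjBy_mul]; congr 1; group
  rw [h1, hs.cross_mul, hp J hJ, hs.cross_mul_other hC hk' _ (Set.mem_univ _) h2, hs.cross_inv, h3,
    hp _ (conjBy_mem_orbitWalls (inv_mem (le_of_mem_orbitWalls hCp hk)) hJ)]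
  group

/-- Every chamber is brought into the chamber of `1` of the coarser partition by an element of the
subgroup generated by the walls adjacent to the latter chamber. -/
theorem exists_mul_eq (hs : IsRotationSystem e Set.univ base₀) (htop : sSup base₀ = ⊤) (g : E) :
    ∃ h ∈ sSup (orbitBase e S), ∃ g', h * g' = g ∧ ∀ J ∈ orbitWalls S, e g' J = 1 := by
  obtain ⟨L, hL, rfl⟩ := exists_isWord (base := base₀) (h := g) (by rw [htop]; exact mem_top g)
  induction L using List.reverseRecOn with
  | nil => exact ⟨1, one_mem _, 1, by simp, fun J _ => hs.cross_one J⟩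
  | append_singleton L x ih =>
    obtain ⟨hL, hx⟩ := isWord_append.1 hL
    obtain ⟨C, hC, hx⟩ := (isWord_cons.1 hx).1
    obtain ⟨h, hh, g', hg, hg'⟩ := ih hL
    rw [List.prod_append, List.prod_singleton, ← hg]
    by_cases hCw : C.conjBy g' ∈ orbitWalls S
    · have h1 : g' * x * g'⁻¹ ∈ C.conjBy g' := by
        rw [mem_conjBy]; simpa [mul_assoc] using hx
      refine ⟨h * (g' * x * g'⁻¹), mul_mem hh ?_, g', by group, hg'⟩
      exact (le_sSup (hs.conjBy_mem_orbitBase hg' hC hCw) : _ ≤ sSup (orbitBase e S)) h1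
    · refine ⟨h, hh, g' * x, by group, fun J hJ => ?_⟩
      have h1 : J.conjBy g'⁻¹ ≠ C := fun h => hCw (by rw [← h, conjBy_conjBy_inv]; exact hJ)
      rw [hs.cross_mul, hg' J hJ, hs.other C hC x hx _ (Set.mem_univ _) h1]
      group

theorem sSup_orbitBase (hs : IsRotationSystem e Set.univ base₀) (htop : sSup base₀ = ⊤)
    (hS : ∀ K ∈ S, ∃ g, ∃ C ∈ base₀, K = C.conjBy g) : sSup (orbitBase e S) = sSup S := by
  refine le_antisymm orbitBase_le (sSup_le fun K hK => ?_)
  have hKw : K ∈ orbitWalls S := ⟨1, one_mem _, K, hK, by simp⟩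
  obtain ⟨g, C, hC, rfl⟩ := hS K hK
  obtain ⟨h, hh, g', rfl, hg'⟩ := hs.exists_mul_eq (S := S) htop g
  rw [conjBy_mul] at hKw ⊢
  have h1 : C.conjBy g' ∈ orbitWalls S := by
    have := conjBy_mem_orbitWalls (inv_mem (orbitBase_le hh)) hKw
    rwa [conjBy_inv_conjBy] at this
  exact conjBy_le hh (le_sSup (hs.conjBy_mem_orbitBase hg' hC h1))

end IsRotationSystem

end Heredity

/-! ### Rotations in a semidirect product -/

section Cocycle

/-- The action of `E` on the functions `n` from subgroups of `E` to `E` given by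
`(g • n) J = g (n (g⁻¹ J g)) g⁻¹`. -/
def wallAction : E →* MulAut (Subgroup E → E) where
  toFun g :=
    { toFun := fun n J => g * n (J.conjBy g⁻¹) * g⁻¹
      invFun := fun n J => g⁻¹ * n (J.conjBy g) * g
      left_inv := fun n => by ext J; simp [mul_assoc]
      right_inv := fun n => by ext J; simp [mul_assoc]
      map_mul' := fun n n' => by ext J; simp [mul_assoc] }
  map_one' := by ext n J; simp
  map_mul' g h := by
    ext n J
    simp [mul_assoc, conjBy_mul]

theorem wallAction_apply (g : E) (n : Subgroup E → E) (J : Subgroup E) :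
    wallAction g n J = g * n (J.conjBy g⁻¹) * g⁻¹ := rfl

open Classical in
/-- The rotation `x` around `K`, together with the value of the crossed homomorphism at `x`:
this rotation crosses the wall `K` only. -/
noncomputable def wallRotation (K : Subgroup E) (x : E) : (Subgroup E → E) ⋊[wallAction] E :=
  ⟨fun J => if J = K then x⁻¹ else 1, x⟩

theorem wallRotation_mul {K : Subgroup E} {x : E} (hx : x ∈ K) (y : E) :
    wallRotation K (x * y) = wallRotation K x * wallRotation K y := by
  refine SemidirectProduct.ext ?_ rfl
  ext J
  have h1 : J.conjBy x⁻¹ = K ↔ J = K := by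
    rw [conjBy_eq_iff, inv_inv, conjBy_eq_self hx]
  by_cases hJ : J = K
  · simp [wallRotation, wallAction_apply, hJ, conjBy_eq_self (inv_mem hx), mul_assoc]
  · simp [wallRotation, wallAction_apply, hJ, h1]

theorem wallRotation_comm {K K' : Subgroup E} (h : ∀ x ∈ K, ∀ y ∈ K', x * y = y * x) {x y : E}
    (hx : x ∈ K) (hy : y ∈ K') :
    wallRotation K x * wallRotation K' y = wallRotation K' y * wallRotation K x := by
  have hc : ∀ (M : Subgroup E) (z : E), (∀ w ∈ M, z * w = w * z) → M.conjBy z = M := by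
    intro M z hz
    ext w
    rw [mem_conjBy]
    constructor
    · intro hw
      have h1 := hz _ hw
      have h2 : w = z⁻¹ * w * z := by
        rw [← mul_left_inj z, ← h1]; group
      rw [h2]; exact hw
    · intro hw
      rwa [mul_assoc, ← hz w hw, inv_mul_cancel_left]
  have h1 := hc K y fun w hw => (h w hw y hy).symm
  have h2 := hc K' x fun w hw => h x hx w hw
  have h3 : ∀ J, (wallRotation K' y).left (J.conjBy x⁻¹) = (wallRotation K' y).left J :=
    fun J => by classical exact if_congr (by rw [conjBy_eq_iff, inv_inv, h2]) rfl rfl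
  have h4 : ∀ J, (wallRotation K x).left (J.conjBy y⁻¹) = (wallRotation K x).left J :=
    fun J => by classical exact if_congr (by rw [conjBy_eq_iff, inv_inv, h1]) rfl rfl
  have hxy := h x hx y hy
  have hxy' : x * y⁻¹ = y⁻¹ * x := h x hx _ (inv_mem hy)
  have hxy'' : y * x⁻¹ = x⁻¹ * y := (h _ (inv_mem hx) y hy).symm
  have hi : x⁻¹ * y⁻¹ = y⁻¹ * x⁻¹ := h _ (inv_mem hx) _ (inv_mem hy)
  refine SemidirectProduct.ext ?_ hxy
  ext J
  rw [SemidirectProduct.mul_left, SemidirectProduct.mul_left, Pi.mul_apply, Pi.mul_apply,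
    wallAction_apply, wallAction_apply, show (wallRotation K x).right = x from rfl,
    show (wallRotation K' y).right = y from rfl, h3, h4]
  simp only [wallRotation]
  split_ifs <;> simp [hxy', hxy'', hi]

theorem alternatingProd_two_mul {M : Type*} [Monoid M] (a b : M) (k : ℕ) :
    alternatingProd a b (2 * k) = (a * b) ^ k := by
  induction k with
  | zero => simp [alternatingProd]
  | succ k ih =>
    rw [show 2 * (k + 1) = 2 * k + 1 + 1 by ring, alternatingProd, alternatingProd, ih, pow_succ',
      mul_assoc]

theorem alternatingProd_two_mul_add_one {M : Type*} [Monoid M] (a b : M) (k : ℕ) :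
    alternatingProd a b (2 * k + 1) = (a * b) ^ k * a := by
  induction k with
  | zero => simp [alternatingProd]
  | succ k ih =>
    rw [show 2 * (k + 1) + 1 = 2 * k + 1 + 1 + 1 by ring, alternatingProd, alternatingProd, ih,
      pow_succ']
    simp only [mul_assoc]

theorem conjBy_zpowers (x s : E) : (zpowers s).conjBy x = zpowers (x * s * x⁻¹) := by
  rw [conjBy, MonoidHom.map_zpowers]; rfl

theorem eq_of_zpowers_eq {s t : E} (hs : s * s = 1) (ht : t * t = 1)
    (h : zpowers s = zpowers t) : s = t := by
  have key : ∀ a b : E, b * b = 1 → a ∈ zpowers b → a = 1 ∨ a = b := by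
    rintro a b hb ⟨n, rfl⟩
    have hb' : b ^ (2 : ℤ) = 1 := by rw [zpow_two, hb]
    rcases Int.even_or_odd' n with ⟨k, rfl | rfl⟩
    · left; simp [zpow_mul, hb']
    · right; simp [zpow_add, zpow_mul, hb']
  rcases key s t ht (h ▸ mem_zpowers s) with rfl | h1
  · rcases key t 1 (by simp) (h ▸ mem_zpowers t) with h2 | h2 <;> exact h2.symm
  · exact h1

/-- In a product of rotations of order two, the component at a wall is a power of the rotation
around that wall, the exponent being the number of times that the wall is crossed. -/
theorem left_alternatingProd_wallRotation [DecidableEq (Subgroup E)] {x y : E} (hx : x * x = 1)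
    (hy : y * y = 1) (n : ℕ) (J : Subgroup E) (t : E)
    (ht : ∀ s, s * s = 1 → J = zpowers s → s = t) :
    (alternatingProd (wallRotation (zpowers x) x) (wallRotation (zpowers y) y) n).left J =
      t⁻¹ ^ (∑ i ∈ Finset.range n,
        if J = zpowers (alternatingProd x y (2 * i + 1)) then 1 else 0) := by
  induction n generalizing x y J t with
  | zero => simp [alternatingProd]
  | succ n ih =>
    have h1 := ih hy hx (J.conjBy x⁻¹) (x⁻¹ * t * x) fun s hs hJ => by
      rw [conjBy_eq_iff, inv_inv, conjBy_zpowers] at hJ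
      have h2 : x * s * x⁻¹ * (x * s * x⁻¹) = x * (s * s) * x⁻¹ := by group
      rw [← ht (x * s * x⁻¹) (by rw [h2, hs]; group) hJ]
      group
    have hx' : x⁻¹ = x := inv_eq_of_mul_eq_one_left hx
    have h2 : ∀ i, (J.conjBy x⁻¹ = zpowers (alternatingProd y x (2 * i + 1))) ↔
        J = zpowers (alternatingProd x y (2 * (i + 1) + 1)) := fun i => by
      have h3 : x * alternatingProd y x (2 * i + 1) * x⁻¹ =
          x * alternatingProd y x (2 * (i + 1)) := by
        rw [alternatingProd_two_mul, alternatingProd_two_mul_add_one, pow_succ, hx']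
        simp only [mul_assoc]
      rw [conjBy_eq_iff, inv_inv, conjBy_zpowers, h3]
      rfl
    simp only [h2] at h1
    rw [alternatingProd, SemidirectProduct.mul_left, Pi.mul_apply, wallAction_apply,
      show (wallRotation (zpowers x) x).right = x from rfl, h1, Finset.sum_range_succ', pow_add]
    have h3 : ∀ k : ℕ, x * (x⁻¹ * t * x)⁻¹ ^ k * x⁻¹ = t⁻¹ ^ k := fun k => by
      rw [← conj_pow]; congr 1; group
    rw [h3]
    have h4 : (wallRotation (zpowers x) x).left J =
        t⁻¹ ^ (if J = zpowers (alternatingProd x y (2 * 0 + 1)) then 1 else 0) := by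
      have h5 : alternatingProd x y (2 * 0 + 1) = x := by simp [alternatingProd]
      rw [h5]
      by_cases hJ : J = zpowers x
      · simp [wallRotation, ← ht x hx hJ, hJ]
      · simp [wallRotation, hJ]
    rw [h4, ← pow_add, ← pow_add, add_comm]

theorem mul_pow_eq_one {x y : E} (hx : x * x = 1) (hy : y * y = 1) {k : ℕ}
    (h : alternatingProd x y k = alternatingProd y x k) : (x * y) ^ k = 1 := by
  have hx' : x⁻¹ = x := inv_eq_of_mul_eq_one_left hx
  have hy' : y⁻¹ = y := inv_eq_of_mul_eq_one_left hy
  have hyx : y * x = (x * y)⁻¹ := by rw [mul_inv_rev, hx', hy']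
  rcases Nat.even_or_odd' k with ⟨j, rfl | rfl⟩
  · rw [alternatingProd_two_mul, alternatingProd_two_mul, hyx, inv_pow, eq_inv_iff_mul_eq_one,
      ← pow_add] at h
    rw [two_mul, h]
  · rw [alternatingProd_two_mul_add_one, alternatingProd_two_mul_add_one, hyx, inv_pow,
      eq_inv_mul_iff_mul_eq, ← mul_assoc, ← pow_add, ← two_mul] at h
    rw [pow_succ, ← mul_assoc, h, hy]

/-- The rotations of order two satisfy the braid relations that hold in `E`: the two sides of such
a relation cross the same walls, in opposite orders. -/
theorem alternatingProd_wallRotation_comm {x y : E} (hx : x * x = 1) (hy : y * y = 1) {k : ℕ}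
    (h : alternatingProd x y k = alternatingProd y x k) :
    alternatingProd (wallRotation (zpowers x) x) (wallRotation (zpowers y) y) k =
      alternatingProd (wallRotation (zpowers y) y) (wallRotation (zpowers x) x) k := by
  classical
  have hx' : x⁻¹ = x := inv_eq_of_mul_eq_one_left hx
  have hy' : y⁻¹ = y := inv_eq_of_mul_eq_one_left hy
  have hyx : y * x = (x * y)⁻¹ := by rw [mul_inv_rev, hx', hy']
  have hk := mul_pow_eq_one hx hy h
  refine SemidirectProduct.ext ?_ ?_
  · ext J
    obtain ⟨t, ht⟩ : ∃ t, ∀ s, s * s = 1 → J = zpowers s → s = t := by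
      by_cases hJ : ∃ s, s * s = 1 ∧ J = zpowers s
      · obtain ⟨t, ht, rfl⟩ := hJ
        exact ⟨t, fun s hs hst => eq_of_zpowers_eq hs ht hst.symm⟩
      · exact ⟨1, fun s hs hJs => (hJ ⟨s, hs, hJs⟩).elim⟩
    rw [left_alternatingProd_wallRotation hx hy k J t ht,
      left_alternatingProd_wallRotation hy hx k J t ht,
      ← Finset.sum_range_reflect]
    congr 1
    refine Finset.sum_congr rfl fun i hi => ?_
    have hi' : i < k := Finset.mem_range.1 hi
    have h1 : alternatingProd x y (2 * (k - 1 - i) + 1) = alternatingProd y x (2 * i + 1) := by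
      have h2 : (x * y) ^ i * (x * y) ^ (k - 1 - i) * (x * y) = 1 := by
        rw [← pow_add, ← pow_succ, show i + (k - 1 - i) + 1 = k by omega, hk]
      rw [alternatingProd_two_mul_add_one, alternatingProd_two_mul_add_one, hyx, inv_pow,
        eq_inv_mul_iff_mul_eq, ← mul_assoc]
      rw [← mul_assoc, mul_eq_one_iff_eq_inv, hy'] at h2
      exact h2
    rw [h1]
  · have h1 : ∀ a b : E,
        (alternatingProd (wallRotation (zpowers a) a) (wallRotation (zpowers b) b) k).right =
          alternatingProd a b k := fun a b =>
      map_alternatingProd SemidirectProduct.rightHom _ _ k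
    rw [h1, h1, h]

end Cocycle

/-! ### The rotation system of a periagroup -/

namespace Periagroup

variable {V : Type u} {Γ : SimpleGraph V} {lam : Γ.edgeSet → ℕ} {G : V → Type v}
  [∀ a, Group (G a)]

theorem alternatingProd_comm_of_eq_two {M : Type*} [Monoid M] {a b : M} {n : ℕ} (hn : n = 2)
    (h : a * b = b * a) : alternatingProd a b n = alternatingProd b a n := by
  subst hn; simp [alternatingProd, h]

theorem of_mem (a : V) (x : G a) : of Γ lam G a x ∈ vertexSubgroup Γ lam G a := ⟨x, rfl⟩

theorem of_comm {a b : V} (h : Γ.Adj a b) (hl : lam ⟨s(a, b), h⟩ = 2) (x : G a) (y : G b) :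
    of Γ lam G a x * of Γ lam G b y = of Γ lam G b y * of Γ lam G a x := by
  by_cases hx : x = 1
  · simp [hx]
  by_cases hy : y = 1
  · simp [hy]
  have h1 := alternatingProd_of_comm (lam := lam) h hx hy
  rw [hl] at h1
  simpa [alternatingProd] using h1

theorem eq_one_or_eq_of_card_eq_two {K : Type*} [Group K] (hK : Nat.card K = 2) {x : K}
    (hx : x ≠ 1) (z : K) : z = 1 ∨ z = x := by
  obtain ⟨y, -, hy⟩ := (Nat.card_eq_two_iff' (1 : K)).1 hK
  by_cases hz : z = 1
  · exact Or.inl hz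
  · exact Or.inr ((hy z hz).trans (hy x hx).symm)

theorem mul_self_eq_one_of_card_eq_two {K : Type*} [Group K] (hK : Nat.card K = 2) (x : K) :
    x * x = 1 := by
  by_cases hx : x = 1
  · simp [hx]
  rcases eq_one_or_eq_of_card_eq_two hK hx (x * x) with h | h
  · exact h
  · exact absurd (mul_eq_left.1 h) hx

theorem vertexSubgroup_eq_zpowers {a : V} (ha : Nat.card (G a) = 2) {x : G a} (hx : x ≠ 1) :
    vertexSubgroup Γ lam G a = zpowers (of Γ lam G a x) := by
  apply le_antisymm
  · rintro _ ⟨z, rfl⟩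
    rcases eq_one_or_eq_of_card_eq_two ha hx z with rfl | rfl
    · rw [map_one]; exact one_mem _
    · exact mem_zpowers _
  · rw [zpowers_le]; exact of_mem a x

/-- The rotations around the vertex-groups, as a morphism on each vertex-group. -/
noncomputable def vertexRotation (Γ : SimpleGraph V) (lam : Γ.edgeSet → ℕ) (G : V → Type v)
    [∀ a, Group (G a)] (a : V) :
    G a →* (Subgroup (Periagroup Γ lam G) → Periagroup Γ lam G) ⋊[wallAction] Periagroup Γ lam G :=
  MonoidHom.mk' (fun x => wallRotation (vertexSubgroup Γ lam G a) (of Γ lam G a x)) fun x y => by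
    rw [map_mul, wallRotation_mul (of_mem a x)]

/-- The graph of the crossed homomorphism that records the walls crossed by the elements of a
periagroup. -/
noncomputable def rotationHom (hlam : IsPeriagroupLabelling Γ lam G) :
    Periagroup Γ lam G →*
      (Subgroup (Periagroup Γ lam G) → Periagroup Γ lam G) ⋊[wallAction] Periagroup Γ lam G :=
  lift (vertexRotation Γ lam G) (by
    intro a b h x y hx hy
    change alternatingProd (wallRotation _ _) (wallRotation _ _) _ =
      alternatingProd (wallRotation _ _) (wallRotation _ _) _
    rcases (hlam.1 ⟨s(a, b), h⟩).eq_or_lt with hl | hl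
    · refine alternatingProd_comm_of_eq_two hl.symm
        (wallRotation_comm ?_ (of_mem a x) (of_mem b y))
      rintro _ ⟨x', rfl⟩ _ ⟨y', rfl⟩
      exact of_comm h hl.symm x' y'
    · obtain ⟨ha, hb⟩ := hlam.2 a b h hl
      rw [vertexSubgroup_eq_zpowers ha hx, vertexSubgroup_eq_zpowers hb hy]
      exact alternatingProd_wallRotation_comm
        (by rw [← map_mul, mul_self_eq_one_of_card_eq_two ha, map_one])
        (by rw [← map_mul, mul_self_eq_one_of_card_eq_two hb, map_one])
        (alternatingProd_of_comm h hx hy))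

theorem rotationHom_of (hlam : IsPeriagroupLabelling Γ lam G) (a : V) (x : G a) :
    rotationHom hlam (of Γ lam G a x) = wallRotation (vertexSubgroup Γ lam G a) (of Γ lam G a x) :=
  lift_of _ _ a x

theorem rotationHom_right (hlam : IsPeriagroupLabelling Γ lam G) (g : Periagroup Γ lam G) :
    (rotationHom hlam g).right = g := by
  induction g using induction_left with
  | one => simp
  | mul a x g ih => rw [map_mul, SemidirectProduct.mul_right, ih, rotationHom_of]; rfl

/-- The crossed homomorphism that records the walls crossed by the elements of a periagroup. -/
noncomputable def crossing (hlam : IsPeriagroupLabelling Γ lam G) (g : Periagroup Γ lam G)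
    (J : Subgroup (Periagroup Γ lam G)) : Periagroup Γ lam G :=
  (rotationHom hlam g).left J

theorem crossing_mul (hlam : IsPeriagroupLabelling Γ lam G) (g h : Periagroup Γ lam G)
    (J : Subgroup (Periagroup Γ lam G)) :
    crossing hlam (g * h) J = crossing hlam g J * (g * crossing hlam h (J.conjBy g⁻¹) * g⁻¹) := by
  unfold crossing
  rw [map_mul, SemidirectProduct.mul_left, Pi.mul_apply, wallAction_apply, rotationHom_right]

open Classical in
theorem crossing_of (hlam : IsPeriagroupLabelling Γ lam G) (a : V) (x : G a)
    (J : Subgroup (Periagroup Γ lam G)) :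
    crossing hlam (of Γ lam G a x) J =
      if J = vertexSubgroup Γ lam G a then (of Γ lam G a x)⁻¹ else 1 := by
  unfold crossing
  rw [rotationHom_of]; rfl

theorem isRotationSystem (hlam : IsPeriagroupLabelling Γ lam G) :
    IsRotationSystem (crossing hlam) Set.univ (Set.range (vertexSubgroup Γ lam G)) where
  cross_mul := crossing_mul hlam
  mem g J := by
    induction g using induction_left generalizing J with
    | one => simp [crossing, one_mem]
    | mul a x g ih =>
      rw [crossing_mul, crossing_of]
      refine mul_mem ?_ ?_
      · split_ifs with h
        · rw [h]; exact inv_mem (of_mem a x)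
        · exact one_mem _
      · have := ih (J.conjBy (of Γ lam G a x)⁻¹)
        rwa [mem_conjBy, inv_inv] at this
  base_subset := Set.subset_univ _
  self := by
    rintro _ ⟨a, rfl⟩ _ ⟨x, rfl⟩
    simp [crossing_of]
  other := by
    rintro _ ⟨a, rfl⟩ _ ⟨x, rfl⟩ J - hJ
    simp [crossing_of, hJ]
  stable _ _ _ _ _ _ := Set.mem_univ _

theorem sSup_range_vertexSubgroup : sSup (Set.range (vertexSubgroup Γ lam G)) = ⊤ := by
  rw [eq_top_iff]
  intro g _
  induction g using induction_left with
  | one => exact one_mem _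
  | mul a x g ih =>
    exact mul_mem ((le_sSup (Set.mem_range_self a) :
      vertexSubgroup Γ lam G a ≤ sSup (Set.range (vertexSubgroup Γ lam G))) (of_mem a x))
      (ih (mem_top g))

/-- Vertex-groups embed: a vertex-group of order two is detected by the morphism to the group of
signs that is non-trivial on all the vertex-groups of order two and trivial on the other ones, and
every other vertex-group is a retract. -/
theorem of_injective (hlam : IsPeriagroupLabelling Γ lam G) (a : V) :
    Function.Injective (of Γ lam G a) := by
  classical
  by_cases ha : Nat.card (G a) = 2
  · have hsign : ∀ b, ∃ χ : G b →* ℤˣ, Nat.card (G b) = 2 → ∀ x, x ≠ 1 → χ x = -1 := by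
      intro b
      by_cases hb : Nat.card (G b) = 2
      · refine ⟨MonoidHom.mk' (fun x => if x = 1 then 1 else -1) fun x y => ?_, fun _ x hx => ?_⟩
        · by_cases hx : x = 1
          · simp [hx]
          rcases eq_one_or_eq_of_card_eq_two hb hx y with rfl | rfl
          · simp
          · simp [hx, mul_self_eq_one_of_card_eq_two hb]
        · simp [hx]
      · exact ⟨1, fun h => absurd h hb⟩
    choose χ hχ using hsign
    let ψ : Periagroup Γ lam G →* ℤˣ := lift χ fun b c h x y hx hy => by
      rcases (hlam.1 ⟨s(b, c), h⟩).eq_or_lt with hl | hl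
      · exact alternatingProd_comm_of_eq_two hl.symm (mul_comm _ _)
      · obtain ⟨hb, hc⟩ := hlam.2 b c h hl
        rw [hχ b hb x hx, hχ c hc y hy]
    rw [injective_iff_map_eq_one]
    intro x hx
    by_contra hne
    have h1 : ψ (of Γ lam G a x) = -1 := (lift_of _ _ a x).trans (hχ a ha x hne)
    rw [hx, map_one] at h1
    exact absurd h1 (by decide)
  · let χ : ∀ b, G b →* G a := fun b => (Pi.evalMonoidHom G a).comp (MonoidHom.mulSingle G b)
    have hχ : ∀ b, b ≠ a → ∀ x, χ b x = 1 := fun b hb x => Pi.mulSingle_eq_of_ne hb.symm x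
    let ψ : Periagroup Γ lam G →* G a := lift χ fun b c h x y hx hy => by
      rcases (hlam.1 ⟨s(b, c), h⟩).eq_or_lt with hl | hl
      · refine alternatingProd_comm_of_eq_two hl.symm ?_
        by_cases hb : b = a
        · rw [hχ c (fun hc => h.ne (hb.trans hc.symm))]; simp
        · rw [hχ b hb]; simp
      · obtain ⟨hb, hc⟩ := hlam.2 b c h hl
        rw [hχ b (by rintro rfl; exact ha hb), hχ c (by rintro rfl; exact ha hc)]
    have hψ : ∀ x, ψ (of Γ lam G a x) = x := fun x =>
      (lift_of _ _ a x).trans (Pi.mulSingle_eq_same a x)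
    exact Function.LeftInverse.injective hψ

end Periagroup

/-! ### Subgroups generated by conjugates of vertex-groups -/

theorem theorem1p3 {V : Type u} (Γ : SimpleGraph V) (lam : Γ.edgeSet → ℕ)
    (G : V → Type v) [∀ a, Group (G a)] (hlam : IsPeriagroupLabelling Γ lam G)
    (S : Set (Subgroup (Periagroup Γ lam G)))
    (hS : ∀ K ∈ S, ∃ (g : Periagroup Γ lam G) (a : V),
      K = (Periagroup.vertexSubgroup Γ lam G a).map (MulAut.conj g).toMonoidHom) :
    ∃ (W : Type (max u v)) (Δ : SimpleGraph W) (mu : Δ.edgeSet → ℕ) (f : W → V),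
      IsPeriagroupLabelling Δ mu (fun w => G (f w)) ∧
      ∃ (c : W → Periagroup Γ lam G)
        (φ : Periagroup Δ mu (fun w => G (f w)) ≃* ↥(sSup S : Subgroup (Periagroup Γ lam G))),
        ∀ (w : W) (x : G (f w)),
          (φ (Periagroup.of Δ mu (fun w => G (f w)) w x) : Periagroup Γ lam G) =
            c w * Periagroup.of Γ lam G (f w) x * (c w)⁻¹ := by
  have hs₀ := Periagroup.isRotationSystem hlam
  have hS' : ∀ K ∈ S, ∃ g, ∃ C ∈ Set.range (Periagroup.vertexSubgroup Γ lam G),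
      K = C.conjBy g := fun K hK => by
    obtain ⟨g, a, h⟩ := hS K hK
    exact ⟨g, _, ⟨a, rfl⟩, h⟩
  have hs := hs₀.isRotationSystem_orbitBase hS'
  have hsup := hs₀.sSup_orbitBase Periagroup.sSup_range_vertexSubgroup hS'
  have hw : ∀ w : orbitBase (Periagroup.crossing hlam) S, ∃ (a : V) (c : Periagroup Γ lam G),
      w.1 = (Periagroup.vertexSubgroup Γ lam G a).conjBy c := by
    rintro ⟨_, ⟨h, -, K, hK, rfl⟩, -⟩
    obtain ⟨g, _, ⟨a, rfl⟩, rfl⟩ := hS' K hK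
    exact ⟨a, h * g, (conjBy_mul _ _ _).symm⟩
  choose f c hfc using hw
  let ι : ∀ w, G (f w) →* Periagroup Γ lam G := fun w =>
    (MulAut.conj (c w)).toMonoidHom.comp (Periagroup.of Γ lam G (f w))
  have hinj : ∀ w, Function.Injective (ι w) := fun w =>
    (MulAut.conj (c w)).injective.comp (Periagroup.of_injective hlam (f w))
  have hι : ∀ w, (ι w).range = w.1 := fun w => by
    rw [hfc w, MonoidHom.range_comp]; rfl
  obtain ⟨φ, hφ⟩ := hs.exists_mulEquiv hinj hι
  exact ⟨_, _, _, f, hs.isPeriagroupLabelling hinj hι, c,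
    φ.trans (MulEquiv.subgroupCongr hsup), hφ⟩
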